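/- Let $K$ be a field of characteristic $0$, let $\boldsymbol a=(a_0,a_1,\dots)$ be a sequence in $K$, and let $\boldsymbol x=(x_1,\dots,x_n)\in K^n$ ($n\ge 0$) satisfy $x_i\ne 0$, $x_i^2\ne 1$ for all $i$, and $x_i^2\ne x_j^2$, $(x_ix_j)^2\ne 1$ for $i\ne j$ (for example, the $x_i$ and $a_k$ are indeterminates and $K=\mathbb Q(\boldsymbol x,\boldsymbol a)$). Put $(x|\boldsymbol a)^r=\prod_{k=0}^{r-1}(x+a_k)$. For a strict partition $\lambda=(\lambda_1>\dots>\lambda_l>0)$ of length $l=l(\lambda)\le n$ (with $\lambda_i=0$ for $i>l$), let $$\mathcal P^C_\lambda(\boldsymbol x|\boldsymbol a;t)=\frac1{v^{(n)}_\lambda(t)}\sum_{w\in W_n}w\Bigl(\prod_{i=1}^n(x_i|\boldsymbol a)^{\lambda_i}\prod_{i=1}^n\frac{1-tx_i^{-2}}{1-x_i^{-2}}\prod_{1\le i<j\le n}\frac{1-tx_i^{-1}x_j}{1-x_i^{-1}x_j}\,\frac{1-tx_i^{-1}x_j^{-1}}{1-x_i^{-1}x_j^{-1}}\Bigr),$$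 a rational function of the indeterminate $t$, where $W_n$ is the Weyl group of type $C_n$ acting by permuting and inverting the $x_i$, and $v^{(n)}_\lambda(t)=\prod_{i=1}^{m_0}\frac{1-t^{2i}}{1-t}\prod_{k\ge1}\prod_{i=1}^{m_k}\frac{1-t^i}{1-t}$ with $m_k=\#\{i\in\{1,\dots,n\}:\lambda_i=k\}$. The factorial symplectic $Q$-function is $Q^C_\lambda(\boldsymbol x|\boldsymbol a)=2^{l(\lambda)}\,\mathcal P^C_\lambda(\boldsymbol x|\boldsymbol a;-1)$. Put $\tilde g_0(x|\boldsymbol a)=1$, $\tilde g_d(x|\boldsymbol a)=2\bigl((x|\boldsymbol a)^d-(x^{-1}|\boldsymbol a)^d\bigr)\frac{x+x^{-1}}{x-x^{-1}}$ for $d\ge1$, and, with $u_i=x_i+x_i^{-1}$, let $\tilde A(\boldsymbol x)$ be the skew-symmetric $n\times n$ matrix with off-diagonal entries $\frac{u_j-u_i}{u_j+u_i}$ and zero diagonal; put $\tilde\Delta(\boldsymbol x)=\prod_{1\le i<j\le n}\frac{u_j-u_i}{u_j+u_i}$. For $\alpha=(\alpha_1,\dots,\alpha_r)$ let $\tilde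 W_\alpha(\boldsymbol x|\boldsymbol a)=\bigl(\tilde g_{\alpha_j}(x_i|\boldsymbol a)\bigr)_{1\le i\le n,\,1\le j\le r}$, and put $\lambda^0=(\lambda_1,\dots,\lambda_{l},0)$. Then: 1. For every strict partition $\lambda$ with $l(\lambda)\le n$, the rational function $\mathcal P^C_\lambda(\boldsymbol x|\boldsymbol a;t)$ of $t$ has no pole at $t=-1$, and $$Q^C_\lambda(\boldsymbol x|\boldsymbol a)=\frac1{\tilde\Delta(\boldsymbol x)}\operatorname{Pf}\begin{pmatrix}\tilde A(\boldsymbol x)&\tilde W_{\lambda^*}(\boldsymbol x|\boldsymbol a)\\-{}^t\tilde W_{\lambda^*}(\boldsymbol x|\boldsymbol a)&O\end{pmatrix},$$ where $\lambda^*=\lambda$ if $n+l(\lambda)$ is even and $\lambda^*=\lambda^0$ if $n+l(\lambda)$ is odd. 2. Take the right-hand side of this formula as the definition of $Q^C_\lambda(\boldsymbol x|\boldsymbol a)$ for every strict partition $\lambda$, of any length. Then for every strict partition $\lambda$, $$Q^C_\lambda(\boldsymbol x|\boldsymbol a)=\operatorname{Pf}\bigl(Q^C_{(\lambda_i,\lambda_j)}(\boldsymbol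 x|\boldsymbol a)\bigr)_{1\le i,j\le m},$$ where $m=l(\lambda)$ if $l(\lambda)$ is even and $m=l(\lambda)+1$, $\lambda_m=0$, if $l(\lambda)$ is odd; here $Q^C_{(r,0)}=Q^C_{(r)}$, and the entries on and below the diagonal are those making the matrix skew-symmetric. -/

import Mathlib

/-- A strict partition, written as the list of its parts `λ₁ > λ₂ > ⋯ > λ_l > 0`.  The length
`l(λ)` is the length of the list; the empty list is the empty partition. -/
def IsStrictPartition (lam : List ℕ) : Prop :=
  lam.Pairwise (fun r s => r > s) ∧ ∀ r ∈ lam, 0 < r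

/-- The entry with (zero-based) index `i` of a partition, with `0` beyond the last part. -/
def partAt (lam : List ℕ) (i : ℕ) : ℕ := lam.getD i 0

/-- The Pfaffian
`Pf A = 1 / (2 ^ m m!) ∑_σ sgn(σ) ∏_{i = 1}^m A_{σ(2i-1), σ(2i)}` of a `2m × 2m` skew-symmetric
matrix over a field of characteristic zero (`0` for a matrix of odd size). -/
noncomputable def pfaffian {K : Type*} [Field K] {N : ℕ} (A : Matrix (Fin N) (Fin N) K) : K :=
  if Even N then
    ((2 : K) ^ (N / 2) * ((N / 2).factorial : K))⁻¹ *
      ∑ σ : Equiv.Perm (Fin N), ((Equiv.Perm.sign σ : ℤ) : K) *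
        ∏ i : Fin (N / 2), A (σ ⟨2 * i.val, by omega⟩) (σ ⟨2 * i.val + 1, by omega⟩)
  else 0

/-- The factorial monomial `(x|a)^r = ∏_{i=0}^{r-1} (x + a_i)`. -/
def factorialMonomial {K : Type*} [Field K] (a : ℕ → K) (x : K) (r : ℕ) : K :=
  ∏ i ∈ Finset.range r, (x + a i)

/-- The number of `i ∈ {1, …, n}` with `λ_i = k`, where `λ` is padded by zeros to length `n`. -/
def partMultiplicity (n : ℕ) (lam : List ℕ) (k : ℕ) : ℕ :=
  (Finset.univ.filter (fun i : Fin n => partAt lam i = k)).card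

/-- The Poincaré polynomial `v_λ^{(n)}(t)` of the stabilizer of `λ` in the Weyl group of
type `C_n`, which is of type `C_{m_0} × A_{m_1 - 1} × A_{m_2 - 1} × ⋯` where `m_k` is the
multiplicity of `k` in `(λ_1, …, λ_n)`. -/
noncomputable def stabilizerPoincare {K : Type*} [Field K] (n : ℕ) (lam : List ℕ) (t : K) : K :=
  (∏ i ∈ Finset.range (partMultiplicity n lam 0), (1 - t ^ (2 * (i + 1))) / (1 - t)) *
    ∏ k ∈ (Finset.univ.image (fun i : Fin n => partAt lam i)).erase 0,
      ∏ i ∈ Finset.range (partMultiplicity n lam k), (1 - t ^ (i + 1)) / (1 - t)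

/-- The expression that is symmetrized in the factorial symplectic Hall–Littlewood function. -/
noncomputable def hallLittlewoodTerm {K : Type*} [Field K] {n : ℕ} (lam : List ℕ) (a : ℕ → K)
    (t : K) (x : Fin n → K) : K :=
  (∏ i, factorialMonomial a (x i) (partAt lam i)) *
    (∏ i, (1 - t * (x i ^ 2)⁻¹) / (1 - (x i ^ 2)⁻¹)) *
    ∏ i, ∏ j ∈ Finset.Ioi i,
      (1 - t * (x i)⁻¹ * x j) / (1 - (x i)⁻¹ * x j) *
        ((1 - t * (x i)⁻¹ * (x j)⁻¹) / (1 - (x i)⁻¹ * (x j)⁻¹))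

/-- The factorial symplectic Hall–Littlewood function `𝒫^C_λ(x|a;t)`, `l(λ) ≤ n`.
The sum is over the Weyl group of type `C_n`: the pair `(σ, ε)` is the signed permutation that
acts by the substitution `x_i ↦ x_{σ(i)}^{ε_i}`. -/
noncomputable def factorialHallLittlewoodC {K : Type*} [Field K] {n : ℕ} (lam : List ℕ)
    (x : Fin n → K) (a : ℕ → K) (t : K) : K :=
  (stabilizerPoincare n lam t)⁻¹ *
    ∑ w : Equiv.Perm (Fin n) × (Fin n → ℤˣ),
      hallLittlewoodTerm lam a t (fun i => x (w.1 i) ^ ((w.2 i : ℤˣ) : ℤ))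

/-- `𝒫^C_λ(x|a;t)` with an indeterminate `t`, as a rational function of `t`. -/
noncomputable def factorialHallLittlewoodCGeneric {K : Type*} [Field K] {n : ℕ} (lam : List ℕ)
    (x : Fin n → K) (a : ℕ → K) : RatFunc K :=
  factorialHallLittlewoodC lam (fun i => RatFunc.C (x i)) (fun k => RatFunc.C (a k)) RatFunc.X

/-- The factorial symplectic `Q`-function `Q^C_λ(x|a) = 2^{l(λ)} 𝒫^C_λ(x|a;-1)`, `l(λ) ≤ n`.
Since `v_λ^{(n)}(-1) = 0` for `l(λ) < n`, the value at `t = -1` is taken after reduction of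
the rational function of `t`. -/
noncomputable def factorialSymplecticQ {K : Type*} [Field K] {n : ℕ} (lam : List ℕ)
    (x : Fin n → K) (a : ℕ → K) : K :=
  2 ^ lam.length * RatFunc.eval (RingHom.id K) (-1) (factorialHallLittlewoodCGeneric lam x a)

/-- The Laurent polynomial `g̃_d(x|a)`. -/
noncomputable def gTilde {K : Type*} [Field K] (a : ℕ → K) (d : ℕ) (x : K) : K :=
  if d = 0 then 1
  else 2 * (factorialMonomial a x d - factorialMonomial a x⁻¹ d) * ((x + x⁻¹) / (x - x⁻¹))

/-- The entry `((x_j + x_j⁻¹) - (x_i + x_i⁻¹)) / ((x_j + x_j⁻¹) + (x_i + x_i⁻¹))` of `Ã(x)`. -/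
noncomputable def matATilde {K : Type*} [Field K] {n : ℕ} (x : Fin n → K) :
    Matrix (Fin n) (Fin n) K :=
  Matrix.of fun i j => ((x j + (x j)⁻¹) - (x i + (x i)⁻¹)) / ((x j + (x j)⁻¹) + (x i + (x i)⁻¹))

/-- `Δ̃(x)`, the product of the entries of `Ã(x)` above the diagonal. -/
noncomputable def deltaTilde {K : Type*} [Field K] {n : ℕ} (x : Fin n → K) : K :=
  ∏ i, ∏ j ∈ Finset.Ioi i,
    ((x j + (x j)⁻¹) - (x i + (x i)⁻¹)) / ((x j + (x j)⁻¹) + (x i + (x i)⁻¹))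

/-- The `n × r` matrix `W̃_α(x|a) = (g̃_{α_j}(x_i|a))`, for `α = (α_1, …, α_r)`. -/
noncomputable def matWTilde {K : Type*} [Field K] {n : ℕ} (alpha : List ℕ) (x : Fin n → K)
    (a : ℕ → K) : Matrix (Fin n) (Fin alpha.length) K :=
  Matrix.of fun i j => gTilde a (alpha.get j) (x i)

/-- The block matrix `[Ã(x), W̃_α(x|a); -W̃_α(x|a)ᵀ, O]`, with rows and columns in this order. -/
noncomputable def nimmoMatrix {K : Type*} [Field K] {n : ℕ} (alpha : List ℕ) (x : Fin n → K)
    (a : ℕ → K) : Matrix (Fin (n + alpha.length)) (Fin (n + alpha.length)) K :=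
  Matrix.reindex finSumFinEquiv finSumFinEquiv
    (Matrix.fromBlocks (matATilde x) (matWTilde alpha x a) (-(matWTilde alpha x a).transpose) 0)

/-- The right-hand side of the Nimmo-type formula, for a strict partition `λ` of any length;
if `n + l(λ)` is odd then `λ` is replaced by `λ⁰ = (λ_1, …, λ_l, 0)`. -/
noncomputable def nimmoQ {K : Type*} [Field K] {n : ℕ} (lam : List ℕ) (x : Fin n → K)
    (a : ℕ → K) : K :=
  if Even (n + lam.length) then 1 / deltaTilde x * pfaffian (nimmoMatrix lam x a)
  else 1 / deltaTilde x * pfaffian (nimmoMatrix (lam ++ [0]) x a)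

/-- The function `Q^C_{(r,s)}(x|a)` for `r > s ≥ 0`, given by the Nimmo-type formula, where
`(r, 0)` is the partition `(r)`. -/
noncomputable def nimmoQPair {K : Type*} [Field K] {n : ℕ} (r s : ℕ) (x : Fin n → K)
    (a : ℕ → K) : K :=
  if s = 0 then nimmoQ [r] x a else nimmoQ [r, s] x a

/-- The number `m`, which is `l` or `l + 1` according as `l` is even or odd. -/
def evenSize (l : ℕ) : ℕ := if Even l then l else l + 1

/-- The skew-symmetric `m × m` matrix with entry `Q^C_{(λ_i, λ_j)}(x|a)` for `i < j`
(and `λ_m = 0` if `l(λ)` is odd). -/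
noncomputable def schurMatrix {K : Type*} [Field K] {n : ℕ} (lam : List ℕ) (x : Fin n → K)
    (a : ℕ → K) : Matrix (Fin (evenSize lam.length)) (Fin (evenSize lam.length)) K :=
  Matrix.of fun i j =>
    if i < j then nimmoQPair (partAt lam i) (partAt lam j) x a
    else if j < i then -nimmoQPair (partAt lam j) (partAt lam i) x a
    else 0

/-! ### Permutations sorted by the image of the first point. -/

open Equiv

/-! For the first assertion both sides obey one recursion, which removes the largest part r together
with one variable x_p. On the Weyl group side (`weylSum_succ`) the signed permutations are sorted by
the image x_p^{±1} of the first variable. The factor of a pair (y, z) is invariant under z ↦ z⁻¹, so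
what remains is a Weyl sum in the other variables for λ without r. Since positive parts are
distinct, v_λ depends only on the number of zeros, which does not change. The coefficients are
polynomial in t and the empty partition gives 1 by Macdonald's formula, so 𝒫 is a polynomial in t.
At t = -1 the pair factors become (u_p + u_j)/(u_p - u_j), and twice the sum over the two signs
gives g̃_r.

On the Pfaffian side (`nimmoQ_cons`) the recursion is the expansion along the row of r, divided by
Δ̃. It ends at Schur's Pfaffian Pf Ã = Δ̃, bordered by ones for odd n. This and Macdonald's formula
both come from Lagrange interpolation.

The second assertion is formal: if Pf Z ≠ 0, then Pf(Z ++ J)/Pf Z is the Pfaffian of the numbers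
Pf(Z ++ [r, s])/Pf Z (`listPf_append_eq_mul`). Here Z lists the variables and J the parts, each
completed to even length. For odd n, Z is completed by the part 0; if l is odd as well, J is
completed by a symbol ∞ that pairs only with 0 and cancels it.

Rows are labelled by lists, so that deleting and moving rows become list operations. -/

theorem cycleRange_mul_decomposeFin_bijective (n : ℕ) :
    Function.Bijective (fun p : Fin (n + 1) × Perm (Fin n) =>
      p.1.cycleRange.symm * Perm.decomposeFin.symm (0, p.2)) := by
  rw [Fintype.bijective_iff_injective_and_card]
  refine ⟨?_, by simp [Fintype.card_perm, Nat.factorial_succ]⟩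
  rintro ⟨i, s⟩ ⟨j, t⟩ h
  simp only at h
  have h0 : i = j := by simpa using congrArg (fun e : Perm (Fin (n + 1)) => e 0) h
  subst h0
  have := Perm.decomposeFin.symm.injective (mul_left_cancel h)
  simpa using this

/-- Serves both the Pfaffian expansion and the Weyl group recursion: `p` is the image of 0, and `t`
arranges the remaining points, whose order the cycle preserves. -/
theorem sum_perm_fin_succ {M : Type*} [AddCommMonoid M] {n : ℕ} (F : Perm (Fin (n + 1)) → M) :
    ∑ s, F s = ∑ p : Fin (n + 1), ∑ t : Perm (Fin n),
      F (p.cycleRange.symm * Perm.decomposeFin.symm (0, t)) := by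
  rw [← Fintype.sum_prod_type']
  exact ((cycleRange_mul_decomposeFin_bijective n).sum_comp F).symm

theorem cycleRange_mul_decomposeFin_zero {n : ℕ} (p : Fin (n + 1)) (t : Perm (Fin n)) :
    (p.cycleRange.symm * Perm.decomposeFin.symm (0, t)) 0 = p := by simp

theorem cycleRange_mul_decomposeFin_succ {n : ℕ} (p : Fin (n + 1)) (t : Perm (Fin n))
    (k : Fin n) :
    (p.cycleRange.symm * Perm.decomposeFin.symm (0, t)) k.succ = p.succAbove (t k) := by simp

theorem sign_cycleRange_mul_decomposeFin {n : ℕ} (p : Fin (n + 1)) (t : Perm (Fin n)) :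
    Perm.sign (p.cycleRange.symm * Perm.decomposeFin.symm (0, t)) =
      (-1) ^ (p : ℕ) * Perm.sign t := by
  simp [Perm.sign_mul, Perm.decomposeFin.symm_sign, Perm.sign_symm]

/-! ### Row expansion and row permutation for Pfaffians. -/

section Pfaffian

variable {K : Type*} [Field K]

/-- The position `2i` (zero-based) of the first member of the pair number `i`. -/
def evenPos {m : ℕ} (i : Fin m) : Fin (2 * m) := ⟨2 * i.val, by omega⟩

/-- The position `2i + 1` (zero-based) of the second member of the pair number `i`. -/
def oddPos {m : ℕ} (i : Fin m) : Fin (2 * m) := ⟨2 * i.val + 1, by omega⟩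

theorem evenPos_injective {m : ℕ} : Function.Injective (evenPos (m := m)) := by
  intro i j h
  simp only [evenPos, Fin.ext_iff] at h ⊢
  omega

theorem oddPos_injective {m : ℕ} : Function.Injective (oddPos (m := m)) := by
  intro i j h
  simp only [oddPos, Fin.ext_iff] at h ⊢
  omega

theorem evenPos_ne_oddPos {m : ℕ} (i j : Fin m) : evenPos i ≠ oddPos j := by
  simp only [evenPos, oddPos, ne_eq, Fin.ext_iff]
  omega

/-- The summand of the Pfaffian of a `2m × 2m` matrix. -/
def pfaffianTerm {m : ℕ} (A : Matrix (Fin (2 * m)) (Fin (2 * m)) K) (s : Perm (Fin (2 * m))) : K :=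
  ((Perm.sign s : ℤ) : K) * ∏ i : Fin m, A (s (evenPos i)) (s (oddPos i))

theorem pfaffian_two_mul {m : ℕ} (A : Matrix (Fin (2 * m)) (Fin (2 * m)) K) :
    pfaffian A = ((2 : K) ^ m * (m.factorial : K))⁻¹ * ∑ s, pfaffianTerm A s := by
  have h : 2 * m / 2 = m := by omega
  rw [pfaffian, if_pos (even_two_mul m)]
  congr 1
  · rw [h]
  · refine Finset.sum_congr rfl fun s _ => congrArg _ ?_
    exact Fintype.prod_equiv (finCongr h) _ _ fun i => rfl

/-- The permutation that exchanges the positions `2k` and `2k + 1`. -/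
def swapInPair {m : ℕ} (k : Fin m) : Perm (Fin (2 * m)) := swap (evenPos k) (oddPos k)

/-- The permutation that exchanges the pairs of positions number `k` and number `l`. -/
def swapPairs {m : ℕ} (k l : Fin m) : Perm (Fin (2 * m)) :=
  swap (evenPos k) (evenPos l) * swap (oddPos k) (oddPos l)

theorem pfaffianTerm_mul_swapInPair {m : ℕ} {A : Matrix (Fin (2 * m)) (Fin (2 * m)) K}
    (hA : ∀ i j, A i j = -A j i) (s : Perm (Fin (2 * m))) (k : Fin m) :
    pfaffianTerm A (s * swapInPair k) = pfaffianTerm A s := by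
  have hs : Perm.sign (swapInPair k) = -1 := Perm.sign_swap (evenPos_ne_oddPos k k)
  rw [pfaffianTerm, pfaffianTerm, Perm.sign_mul, hs, ← Finset.mul_prod_erase _ _ (Finset.mem_univ k),
    ← Finset.mul_prod_erase _ _ (Finset.mem_univ k)]
  have h1 : ∀ i ∈ Finset.univ.erase k,
      A ((s * swapInPair k) (evenPos i)) ((s * swapInPair k) (oddPos i)) =
        A (s (evenPos i)) (s (oddPos i)) := by
    intro i hi
    have hik := (Finset.mem_erase.1 hi).1
    rw [Perm.mul_apply, Perm.mul_apply, swapInPair,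
      swap_apply_of_ne_of_ne (evenPos_injective.ne hik) (evenPos_ne_oddPos _ _),
      swap_apply_of_ne_of_ne (evenPos_ne_oddPos _ _).symm (oddPos_injective.ne hik)]
  rw [Finset.prod_congr rfl h1]
  simp only [Perm.mul_apply, swapInPair, swap_apply_left, swap_apply_right]
  rw [hA]
  push_cast
  ring

theorem swapPairs_evenPos {m : ℕ} (k l i : Fin m) :
    swapPairs k l (evenPos i) = evenPos (swap k l i) := by
  rw [swapPairs, Perm.mul_apply,
    swap_apply_of_ne_of_ne (evenPos_ne_oddPos _ _) (evenPos_ne_oddPos _ _),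
    evenPos_injective.swap_apply]

theorem swapPairs_oddPos {m : ℕ} (k l i : Fin m) :
    swapPairs k l (oddPos i) = oddPos (swap k l i) := by
  rw [swapPairs, Perm.mul_apply, oddPos_injective.swap_apply,
    swap_apply_of_ne_of_ne (evenPos_ne_oddPos _ _).symm (evenPos_ne_oddPos _ _).symm]

theorem pfaffianTerm_mul_swapPairs {m : ℕ} (A : Matrix (Fin (2 * m)) (Fin (2 * m)) K)
    (s : Perm (Fin (2 * m))) (k l : Fin m) :
    pfaffianTerm A (s * swapPairs k l) = pfaffianTerm A s := by
  have hs : Perm.sign (swapPairs k l) = 1 := by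
    rw [swapPairs, Perm.sign_mul, Perm.sign_swap', Perm.sign_swap']
    simp only [evenPos_injective.eq_iff, oddPos_injective.eq_iff]
    split_ifs <;> simp
  rw [pfaffianTerm, pfaffianTerm, Perm.sign_mul, hs, mul_one]
  congr 1
  simp only [Perm.mul_apply, swapPairs_evenPos, swapPairs_oddPos]
  exact Equiv.prod_comp (swap k l) (fun i => A (s (evenPos i)) (s (oddPos i)))

/-- The symmetries of the summand act transitively on positions: exchange whole pairs, then, for odd
`p`, the two members of a pair. -/
theorem exists_perm_pfaffianTerm_mul {m : ℕ} {A : Matrix (Fin (2 * (m + 1))) (Fin (2 * (m + 1))) K}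
    (hA : ∀ i j, A i j = -A j i) (p : Fin (2 * (m + 1))) :
    ∃ t : Perm (Fin (2 * (m + 1))), t 0 = p ∧
      ∀ s, pfaffianTerm A (s * t) = pfaffianTerm A s := by
  have hk : p.val / 2 < m + 1 := by omega
  have h0 : swapPairs 0 ⟨p.val / 2, hk⟩ 0 = evenPos ⟨p.val / 2, hk⟩ := by
    have := swapPairs_evenPos (0 : Fin (m + 1)) ⟨p.val / 2, hk⟩ 0
    rwa [swap_apply_left] at this
  rcases Nat.even_or_odd' p.val with ⟨c, hc | hc⟩
  · refine ⟨swapPairs 0 ⟨p.val / 2, hk⟩, ?_, fun s => pfaffianTerm_mul_swapPairs A s _ _⟩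
    rw [h0, evenPos, Fin.ext_iff]
    simp only
    omega
  · refine ⟨swapInPair ⟨p.val / 2, hk⟩ * swapPairs 0 ⟨p.val / 2, hk⟩, ?_, fun s => ?_⟩
    · rw [Perm.mul_apply, h0, swapInPair, swap_apply_left, oddPos, Fin.ext_iff]
      simp only
      omega
    · rw [← mul_assoc, pfaffianTerm_mul_swapPairs, pfaffianTerm_mul_swapInPair hA]

/-- By transitivity, each of the 2(m + 1) possible positions of the index 0 contributes equally.
This factor reduces the normalization to that of size 2m. -/
theorem sum_pfaffianTerm_eq {m : ℕ} {A : Matrix (Fin (2 * (m + 1))) (Fin (2 * (m + 1))) K}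
    (hA : ∀ i j, A i j = -A j i) :
    ∑ s, pfaffianTerm A s =
      (2 * (m + 1) : K) * ∑ s with s 0 = 0, pfaffianTerm A s := by
  have h : ∀ p : Fin (2 * (m + 1)), ∑ s with s⁻¹ 0 = p, pfaffianTerm A s =
      ∑ s with s 0 = 0, pfaffianTerm A s := by
    intro p
    obtain ⟨t, ht, hF⟩ := exists_perm_pfaffianTerm_mul hA p
    refine Finset.sum_bij (fun s _ => s * t) ?_ ?_ ?_ ?_
    · intro s hs
      simp only [Finset.mem_filter, Finset.mem_univ, true_and] at hs ⊢
      rw [Perm.mul_apply, ht, ← hs]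
      simp
    · intro s _ s' _ h
      exact mul_right_cancel h
    · intro s hs
      simp only [Finset.mem_filter, Finset.mem_univ, true_and] at hs
      refine ⟨s * t⁻¹, ?_, by simp⟩
      simp only [Finset.mem_filter, Finset.mem_univ, true_and, mul_inv_rev, inv_inv,
        Perm.mul_apply]
      rw [← ht]
      congr 1
      rw [Perm.inv_eq_iff_eq, hs]
    · intro s _
      rw [hF]
  rw [← Finset.sum_fiberwise (s := Finset.univ) (g := fun s : Perm (Fin (2 * (m + 1))) => s⁻¹ 0),
    Finset.sum_congr rfl (fun p _ => h p)]
  simp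

theorem sum_perm_fixing_zero {M : Type*} [AddCommMonoid M] {n : ℕ} (F : Perm (Fin (n + 1)) → M) :
    ∑ s with s 0 = 0, F s = ∑ t : Perm (Fin n), F (Perm.decomposeFin.symm (0, t)) := by
  rw [Finset.sum_filter, sum_perm_fin_succ, Fin.sum_univ_succ]
  simp only [cycleRange_mul_decomposeFin_zero, if_true, Fin.succ_ne_zero, if_false,
    Finset.sum_const_zero, add_zero]
  refine Finset.sum_congr rfl fun t _ => ?_
  rw [Fin.cycleRange_zero]
  exact congrArg F (one_mul _)

theorem pfaffian_of_odd {N : ℕ} (hN : ¬ Even N) (A : Matrix (Fin N) (Fin N) K) :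
    pfaffian A = 0 := if_neg hN

/-- The first pair gives the entry `A 0 j.succ`; the other pairs see only the matrix without these
two rows and columns. -/
theorem pfaffianTerm_decomposeFin {m : ℕ} (A : Matrix (Fin (2 * (m + 1))) (Fin (2 * (m + 1))) K)
    (j : Fin (2 * m + 1)) (t : Perm (Fin (2 * m))) :
    pfaffianTerm A (Perm.decomposeFin.symm
        (0, j.cycleRange.symm * Perm.decomposeFin.symm (0, t))) =
      (-1) ^ (j : ℕ) * A 0 j.succ *
        pfaffianTerm (A.submatrix (fun k => (j.succAbove k).succ)
          (fun k => (j.succAbove k).succ)) t := by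
  set e := j.cycleRange.symm * Perm.decomposeFin.symm (0, t) with he
  have hsucc : ∀ i : Fin (2 * m + 1), Perm.decomposeFin.symm (0, e) i.succ = (e i).succ := by
    intro i; simp
  rw [pfaffianTerm, pfaffianTerm, Fin.prod_univ_succ, Perm.decomposeFin.symm_sign, if_pos rfl,
    one_mul, he, sign_cycleRange_mul_decomposeFin, ← he]
  have h0 : A (Perm.decomposeFin.symm (0, e) (evenPos (0 : Fin (m + 1))))
      (Perm.decomposeFin.symm (0, e) (oddPos (0 : Fin (m + 1)))) = A 0 j.succ := by
    have h : Perm.decomposeFin.symm (0, e) (oddPos (0 : Fin (m + 1))) = j.succ := by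
      refine (hsucc 0).trans ?_
      rw [he, cycleRange_mul_decomposeFin_zero]
    rw [h]
    exact congrArg (A · j.succ) (Perm.decomposeFin_symm_apply_zero 0 e)
  have h1 : ∀ i : Fin m, A (Perm.decomposeFin.symm (0, e) (evenPos i.succ))
      (Perm.decomposeFin.symm (0, e) (oddPos i.succ)) =
      A (j.succAbove (t (evenPos i))).succ (j.succAbove (t (oddPos i))).succ := by
    intro i
    have h : Perm.decomposeFin.symm (0, e) (evenPos i.succ) =
        (j.succAbove (t (evenPos i))).succ := by
      refine (hsucc (evenPos i).succ).trans ?_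
      rw [he, cycleRange_mul_decomposeFin_succ]
    have h' : Perm.decomposeFin.symm (0, e) (oddPos i.succ) =
        (j.succAbove (t (oddPos i))).succ := by
      refine (hsucc (oddPos i).succ).trans ?_
      rw [he, cycleRange_mul_decomposeFin_succ]
    rw [h, h']
  rw [h0, Finset.prod_congr rfl fun i _ => h1 i]
  simp only [Matrix.submatrix_apply]
  push_cast
  ring

/-- Expansion of the Pfaffian of a skew-symmetric matrix along the first row. -/
theorem pfaffian_succ_succ [CharZero K] {N : ℕ} {A : Matrix (Fin (N + 2)) (Fin (N + 2)) K}
    (hA : ∀ i j, A i j = -A j i) :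
    pfaffian A = ∑ j : Fin (N + 1), (-1) ^ (j : ℕ) * A 0 j.succ *
      pfaffian (A.submatrix (fun k => (j.succAbove k).succ) (fun k => (j.succAbove k).succ)) := by
  by_cases hN : Even N
  · obtain ⟨m, rfl⟩ := hN.exists_two_nsmul
    simp only [smul_eq_mul] at A hA ⊢
    rw [pfaffian_two_mul (m := m + 1) A, sum_pfaffianTerm_eq (m := m) hA]
    refine (congrArg _ (congrArg _ (sum_perm_fixing_zero (n := 2 * m + 1) _))).trans ?_
    rw [sum_perm_fin_succ]
    simp only [pfaffianTerm_decomposeFin, pfaffian_two_mul, ← Finset.mul_sum]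
    have h2 : (m : K) + 1 ≠ 0 := by exact_mod_cast Nat.succ_ne_zero m
    have h3 : (m.factorial : K) ≠ 0 := by exact_mod_cast Nat.factorial_ne_zero m
    rw [Finset.mul_sum, Finset.mul_sum]
    refine Finset.sum_congr rfl fun j _ => ?_
    rw [Nat.factorial_succ]
    push_cast
    field_simp
    ring
  · rw [pfaffian_of_odd (by simpa [Nat.even_add] using hN)]
    simp [pfaffian_of_odd hN]

theorem pfaffian_submatrix_perm {N : ℕ} (A : Matrix (Fin N) (Fin N) K) (e : Perm (Fin N)) :
    pfaffian (A.submatrix e e) = ((Perm.sign e : ℤ) : K) * pfaffian A := by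
  by_cases hN : Even N
  · rw [pfaffian, pfaffian, if_pos hN, if_pos hN, mul_left_comm]
    congr 1
    rw [Finset.mul_sum]
    refine Fintype.sum_equiv (Equiv.mulLeft e) _ _ fun s => ?_
    simp only [Equiv.coe_mulLeft, Perm.sign_mul, Matrix.submatrix_apply, Perm.mul_apply]
    rw [← mul_assoc]
    congr 1
    rcases Int.units_eq_one_or (Perm.sign e) with h | h <;> simp [h]
  · simp [pfaffian_of_odd hN]

end Pfaffian

/-! ### Alternating sums over the entries of a list. -/

section AlternatingSum

variable {α K : Type*} [Field K]

/-- The alternating sum `∑ (-1)^j F(L_j, L ∖ L_j)` over the positions `j` of a list `L`. -/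
def altSum : (α → List α → K) → List α → K
  | _, [] => 0
  | F, a :: L => F a L - altSum (fun b L' => F b (a :: L')) L

theorem altSum_nil (F : α → List α → K) : altSum F [] = 0 := rfl

theorem altSum_cons (F : α → List α → K) (a : α) (L : List α) :
    altSum F (a :: L) = F a L - altSum (fun b L' => F b (a :: L')) L := rfl

theorem altSum_congr {F G : α → List α → K} {L : List α}
    (h : ∀ b ∈ L, ∀ L' : List α, L'.length + 1 = L.length → F b L' = G b L') :
    altSum F L = altSum G L := by
  induction L generalizing F G with
  | nil => rfl
  | cons a L ih =>
    rw [altSum_cons, altSum_cons, h a (by simp) L (by simp)]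
    congr 1
    exact ih fun b hb L' hL' => h b (by simp [hb]) (a :: L') (by simp [hL'])

theorem altSum_zero (L : List α) : altSum (fun _ _ => (0 : K)) L = 0 := by
  induction L with
  | nil => rfl
  | cons a L ih => rw [altSum_cons, ih, sub_zero]

theorem altSum_eq_zero {F : α → List α → K} {L : List α} (h : ∀ b ∈ L, ∀ L', F b L' = 0) :
    altSum F L = 0 :=
  (altSum_congr fun b hb L' _ => h b hb L').trans (altSum_zero L)

theorem altSum_sub (F G : α → List α → K) (L : List α) :
    altSum (fun b L' => F b L' - G b L') L = altSum F L - altSum G L := by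
  induction L generalizing F G with
  | nil => simp [altSum_nil]
  | cons a L ih => simp only [altSum_cons, ih]; ring

theorem altSum_mul_left (c : K) (F : α → List α → K) (L : List α) :
    altSum (fun b L' => c * F b L') L = c * altSum F L := by
  induction L generalizing F with
  | nil => simp [altSum_nil]
  | cons a L ih => simp only [altSum_cons, ih]; ring

theorem altSum_append (F : α → List α → K) (L₁ L₂ : List α) :
    altSum F (L₁ ++ L₂) = altSum (fun b L' => F b (L' ++ L₂)) L₁ +
      (-1) ^ L₁.length * altSum (fun b L' => F b (L₁ ++ L')) L₂ := by
  induction L₁ generalizing F with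
  | nil => simp [altSum_nil]
  | cons a L ih =>
    simp only [List.cons_append, altSum_cons, ih, List.length_cons]
    ring

theorem altSum_comm (G : α → List α → α → List α → K) (X Y : List α) :
    altSum (fun x X' => altSum (fun y Y' => G x X' y Y') Y) X =
      altSum (fun y Y' => altSum (fun x X' => G x X' y Y') X) Y := by
  induction X generalizing G with
  | nil => simp only [altSum_nil]; exact (altSum_zero Y).symm
  | cons a X ih => simp only [altSum_cons, ih, altSum_sub]

theorem altSum_ofFn {n : ℕ} (F : α → List α → K) (f : Fin (n + 1) → α) :
    altSum F (List.ofFn f) =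
      ∑ p : Fin (n + 1), (-1) ^ (p : ℕ) * F (f p) (List.ofFn fun k => f (p.succAbove k)) := by
  induction n generalizing F with
  | zero => simp [altSum_cons, altSum_nil]
  | succ n ih =>
    have h : ∀ p : Fin (n + 1), (List.ofFn fun k => f (p.succ.succAbove k)) =
        f 0 :: List.ofFn fun k => f (p.succAbove k).succ := fun p => by simp [List.ofFn_succ]
    rw [List.ofFn_succ, altSum_cons, ih, Fin.sum_univ_succ (n := n + 1)]
    rw [sub_eq_add_neg, ← Finset.sum_neg_distrib]
    congr 1
    · simp
    · refine Finset.sum_congr rfl fun p _ => ?_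
      rw [h p, Fin.val_succ, pow_succ]
      ring

end AlternatingSum

/-! ### Pfaffians indexed by lists, and the relative Pfaffian formula. -/

section ListPfaffian

variable {α K : Type*} [Field K]

/-- The Pfaffian of the matrix with entries `B(L_i, L_j)` for a list `L`. -/
noncomputable def listPf (B : α → α → K) (L : List α) : K :=
  pfaffian (Matrix.of fun i j : Fin L.length => B (L.get i) (L.get j))

theorem listPf_eq_of_length_eq {B : α → α → K} {L : List α} {N : ℕ} (h : L.length = N)
    {A : Matrix (Fin N) (Fin N) K}
    (hA : ∀ i j, A i j = B (L.get (i.cast h.symm)) (L.get (j.cast h.symm))) :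
    listPf B L = pfaffian A := by
  subst h
  rw [listPf]
  congr 1
  ext i j
  exact (hA i j).symm

theorem listPf_ofFn (B : α → α → K) {n : ℕ} (f : Fin n → α) :
    listPf B (List.ofFn f) = pfaffian (Matrix.of fun i j => B (f i) (f j)) :=
  listPf_eq_of_length_eq (by simp) fun i j => by simp

theorem listPf_nil (B : α → α → K) : listPf B [] = 1 := by
  rw [listPf, pfaffian, if_pos (by simp)]
  have : IsEmpty (Fin (([] : List α).length / 2)) := inferInstanceAs (IsEmpty (Fin 0))
  have : Subsingleton (Perm (Fin ([] : List α).length)) :=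
    inferInstanceAs (Subsingleton (Perm (Fin 0)))
  rw [Fintype.sum_congr _ (fun _ => 1) fun s => by
    rw [Subsingleton.elim s 1, Fintype.prod_empty]; simp]
  simp

theorem listPf_of_odd {B : α → α → K} {L : List α} (h : ¬ Even L.length) : listPf B L = 0 :=
  pfaffian_of_odd h _

theorem exists_ofFn (L : List α) : ∃ f : Fin L.length → α, List.ofFn f = L :=
  ⟨L.get, List.ofFn_get L⟩

variable {B : α → α → K}

theorem listPf_cons [CharZero K] (hB : ∀ a b, B a b = -B b a) (a : α) (L : List α) :
    listPf B (a :: L) = altSum (fun b L' => B a b * listPf B L') L := by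
  cases L with
  | nil => rw [altSum_nil, listPf_of_odd (by simp)]
  | cons b L =>
    obtain ⟨f, hf⟩ : ∃ f : Fin (L.length + 1) → α, List.ofFn f = b :: L := exists_ofFn (b :: L)
    have h : a :: b :: L = List.ofFn (Fin.cons a f : Fin (L.length + 2) → α) := by
      rw [List.ofFn_succ, ← hf]; simp
    rw [h, ← hf, altSum_ofFn, listPf_ofFn,
      pfaffian_succ_succ (A := Matrix.of _) (fun i j => hB _ _)]
    refine Finset.sum_congr rfl fun j _ => ?_
    rw [listPf_ofFn, mul_assoc]
    rfl

/-- A cycle of sign (-1)^p brings row `p` to the front. -/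
theorem listPf_ofFn_eq {n : ℕ} (f : Fin (n + 1) → α) (p : Fin (n + 1)) :
    listPf B (List.ofFn f) =
      (-1) ^ (p : ℕ) * listPf B (f p :: List.ofFn fun k => f (p.succAbove k)) := by
  have h : f p :: List.ofFn (fun k => f (p.succAbove k)) =
      List.ofFn (fun k => f (p.cycleRange.symm k)) := by
    rw [List.ofFn_succ]; simp
  rw [h, listPf_ofFn, listPf_ofFn]
  have := pfaffian_submatrix_perm (Matrix.of fun i j => B (f i) (f j)) p.cycleRange.symm
  rw [Perm.sign_symm, Fin.sign_cycleRange] at this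
  have h2 : ((-1 : K) ^ (p : ℕ)) * (-1) ^ (p : ℕ) = 1 := by rw [← mul_pow]; simp
  have h3 : (Matrix.of fun i j => B (f (p.cycleRange.symm i)) (f (p.cycleRange.symm j))) =
    (Matrix.of fun i j => B (f i) (f j)).submatrix p.cycleRange.symm p.cycleRange.symm := rfl
  rw [h3, this]
  push_cast
  rw [← mul_assoc, h2, one_mul]

theorem listPf_append_cons (B : α → α → K) (L₁ L₂ : List α) (a : α) :
    listPf B (L₁ ++ a :: L₂) = (-1) ^ L₁.length * listPf B (a :: (L₁ ++ L₂)) := by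
  have hlen : (L₁ ++ a :: L₂).length = (L₁ ++ L₂).length + 1 := by simp; omega
  let f : Fin ((L₁ ++ L₂).length + 1) → α := fun k => (L₁ ++ a :: L₂).get (k.cast hlen.symm)
  have hf : List.ofFn f = L₁ ++ a :: L₂ :=
    List.ext_getElem (by simp; omega) fun i h₁ h₂ => by
      simp only [List.getElem_ofFn, f, List.get_eq_getElem, Fin.val_cast]
  let p : Fin ((L₁ ++ L₂).length + 1) := ⟨L₁.length, by simp⟩
  have h := listPf_ofFn_eq (B := B) f p
  have hp : f p = a := by simp [f, p]
  have hs : (List.ofFn fun k => f (p.succAbove k)) = L₁ ++ L₂ := by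
    refine List.ext_getElem (by simp) fun i h₁ h₂ => ?_
    simp only [List.getElem_ofFn, f, List.get_eq_getElem, Fin.val_cast]
    by_cases hi : i < L₁.length
    · simp [Fin.succAbove, p, Fin.lt_def, hi]
    · have : i + 1 - L₁.length = (i - L₁.length) + 1 := by omega
      simp only [Fin.succAbove, p, Fin.lt_def, Fin.val_castSucc, hi, if_false, Fin.val_succ]
      rw [List.getElem_append_right (by omega), List.getElem_append_right (by omega)]
      simp [this]
  rw [hf, hp, hs] at h
  exact h

theorem listPf_swap (B : α → α → K) (a b : α) (L : List α) :
    listPf B (a :: b :: L) = -listPf B (b :: a :: L) := by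
  simpa using listPf_append_cons B [a] L b

theorem listPf_cons_of_mem [CharZero K] (B : α → α → K) {a : α} {L : List α} (h : a ∈ L) :
    listPf B (a :: L) = 0 := by
  obtain ⟨L₁, L₂, rfl⟩ := List.append_of_mem h
  have h1 := listPf_append_cons B (a :: L₁) L₂ a
  have h2 := listPf_swap B a a (L₁ ++ L₂)
  have h3 : listPf B (a :: a :: (L₁ ++ L₂)) = 0 := self_eq_neg.1 h2
  rw [List.cons_append, List.cons_append, h3, mul_zero] at h1
  exact h1

/-- The quadratic relation between the Pfaffians of the lists obtained from two lists by moving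
one element from one list to the other. -/
theorem listPf_exchange [CharZero K] (hB : ∀ a b, B a b = -B b a) (X Y : List α) :
    altSum (fun x X' => listPf B X' * listPf B (x :: Y)) X +
      altSum (fun y Y' => listPf B Y' * listPf B (y :: X)) Y = 0 := by
  -- Expanding along the moved element turns both sums into the same double sum over X and Y, with
  -- coefficients `B x y` and `B y x`, which cancel.
  simp only [listPf_cons hB, ← altSum_mul_left]
  rw [altSum_comm, ← sub_neg_eq_add, ← neg_one_mul, ← altSum_mul_left, ← altSum_sub]
  refine altSum_eq_zero fun y _ Y' => ?_
  rw [← altSum_mul_left, ← altSum_sub]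
  refine altSum_eq_zero fun x _ X' => ?_
  rw [hB y x]
  ring

theorem listPf_append_cons_of_even (B : α → α → K) {Z : List α} (hZ : Even Z.length) (a : α)
    (L : List α) : listPf B (Z ++ a :: L) = listPf B (a :: (Z ++ L)) := by
  rw [listPf_append_cons, hZ.neg_one_pow, one_mul]

theorem listPf_append_pair (B : α → α → K) {Z : List α} (hZ : Even Z.length) (r s : α) :
    listPf B (Z ++ [r, s]) = listPf B (r :: s :: Z) := by
  have h := listPf_append_cons B (r :: Z) [] s
  rw [List.append_nil, List.length_cons, pow_succ, hZ.neg_one_pow, List.cons_append] at h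
  rw [listPf_append_cons_of_even B hZ, h, listPf_swap B s r]
  ring

/-- The exchange relation for `r :: Z` and `Z ++ J`: moving an element of `Z` repeats a label and
gives zero, so only `r` and the elements of `J` contribute. -/
theorem listPf_mul_listPf_append_cons [CharZero K] (hB : ∀ a b, B a b = -B b a) {Z : List α}
    (hZ : Even Z.length) (r : α) (J : List α) :
    listPf B Z * listPf B (Z ++ r :: J) =
      altSum (fun s J' => listPf B (Z ++ [r, s]) * listPf B (Z ++ J')) J := by
  have h := listPf_exchange hB (r :: Z) (Z ++ J)
  rw [altSum_cons, altSum_eq_zero (L := Z), altSum_append, altSum_eq_zero (L := Z), sub_zero,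
    zero_add, hZ.neg_one_pow, one_mul, ← listPf_append_cons_of_even B hZ] at h
  · rw [eq_neg_of_add_eq_zero_left h, ← neg_one_mul, ← altSum_mul_left]
    refine altSum_congr fun s _ J' _ => ?_
    rw [listPf_append_pair B hZ, listPf_swap B s r Z]
    ring
  · intro z hz L'
    rw [listPf_cons_of_mem B (L := r :: Z) (by simp [hz]), mul_zero]
  · intro z hz L'
    rw [listPf_cons_of_mem B (L := Z ++ J) (by simp [hz]), mul_zero]

theorem listPf_append_pair_div_skew (B : α → α → K) {Z : List α} (hZ : Even Z.length) (r s : α) :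
    listPf B (Z ++ [r, s]) / listPf B Z = -(listPf B (Z ++ [s, r]) / listPf B Z) := by
  rw [listPf_append_pair B hZ, listPf_append_pair B hZ, listPf_swap B s r, neg_div, neg_neg]

/-- The Pfaffian of `Z ++ J` relative to `Z` is the Pfaffian of the pairwise relative
Pfaffians. -/
theorem listPf_append_eq_mul [CharZero K] (hB : ∀ a b, B a b = -B b a) {Z : List α}
    (hZ : Even Z.length) (hZ0 : listPf B Z ≠ 0) (J : List α) :
    listPf B (Z ++ J) =
      listPf B Z * listPf (fun r s => listPf B (Z ++ [r, s]) / listPf B Z) J := by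
  have hS := listPf_append_pair_div_skew B hZ
  induction hl : J.length using Nat.strong_induction_on generalizing J with
  | _ l ih =>
    cases J with
    | nil => simp [listPf_nil]
    | cons r J =>
      -- After multiplication by Pf Z the quadratic relation matches, term by term, the row
      -- expansion of the relative Pfaffian.
      refine mul_left_cancel₀ hZ0 ?_
      rw [listPf_mul_listPf_append_cons hB hZ, listPf_cons hS, ← altSum_mul_left,
        ← altSum_mul_left]
      refine altSum_congr fun s _ J' hJ' => ?_
      rw [ih J'.length (by simp at hl; omega) J' rfl]
      field_simp

end ListPfaffian

/-! ### Rational identities from Lagrange interpolation. -/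

section LagrangeIdentities

variable {ι F : Type*} [Fintype ι] [DecidableEq ι] [Field F]

/-- The monic polynomial ∏ (X - b_i) is interpolated at one node more than the number of its
factors, namely at c and the v_i, and its leading coefficient is read off. -/
theorem prod_div_add_sum_eq_one {v : ι → F} (hv : Function.Injective v) {c : F}
    (hc : ∀ i, v i ≠ c) (b : ι → F) :
    ∏ i, (c - b i) / (c - v i) + ∑ i, (v i - b i) / (v i - c) *
      ∏ j ∈ Finset.univ.erase i, (v i - b j) / (v i - v j) = 1 := by
  let w : Option ι → F := fun o => o.elim c v
  have hw : Set.InjOn w (Finset.univ : Finset (Option ι)) := by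
    rintro (_ | i) _ (_ | j) _ h
    · rfl
    · exact absurd h.symm (hc j)
    · exact absurd h (hc i)
    · exact congrArg some (hv h)
  let P : Polynomial F := ∏ i, (Polynomial.X - Polynomial.C (b i))
  have hP : P.Monic := Polynomial.monic_prod_X_sub_C b Finset.univ
  have hdeg : P.degree = Fintype.card ι := by
    simp [P, Polynomial.degree_prod]
  have h := Lagrange.leadingCoeff_eq_sum hw (P := P) (by rw [hdeg]; simp)
  rw [hP.leadingCoeff, Fintype.sum_option] at h
  have hev : ∀ y, P.eval y = ∏ i, (y - b i) := fun y => by simp [P, Polynomial.eval_prod]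
  have hn : (Finset.univ : Finset (Option ι)).erase none = Finset.univ.map .some := by
    ext (_ | i) <;> simp
  have hs : ∀ i, (Finset.univ : Finset (Option ι)).erase (some i) =
      Finset.cons none ((Finset.univ.erase i).map .some) (by simp) := by
    intro i
    ext (_ | j) <;> simp
  rw [h, hn]
  congr 1
  · rw [hev, Finset.prod_map, Finset.prod_div_distrib]
    rfl
  · refine Finset.sum_congr rfl fun i _ => ?_
    rw [hev, hs, Finset.prod_cons, Finset.prod_map, Finset.prod_div_distrib,
      ← Finset.mul_prod_erase _ _ (Finset.mem_univ i), div_mul_div_comm]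
    rfl

theorem sum_prod_sub_mul_div_sub_of_ne_zero {v : ι → F} (hv : Function.Injective v)
    (h0 : ∀ i, v i ≠ 0) {t : F} (ht : t ≠ 1) :
    ∑ i, ∏ j ∈ Finset.univ.erase i, (v i - t * v j) / (v i - v j) =
      (1 - t ^ Fintype.card ι) / (1 - t) := by
  -- With node c = 0 and b = t v, each factor at c equals t, and each v_i contributes 1 - t.
  have h := prod_div_add_sum_eq_one hv h0 (fun i => t * v i)
  have h1 : ∀ i, (0 - t * v i) / (0 - v i) = t := fun i => by
    have := h0 i
    field_simp
    simp
  have h2 : ∀ i, (v i - t * v i) / (v i - 0) = 1 - t := fun i => by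
    have := h0 i
    field_simp
    simp
  simp only [h1, h2, Finset.prod_const, Finset.card_univ, ← Finset.mul_sum] at h
  rw [eq_div_iff (sub_ne_zero.2 ht.symm)]
  linear_combination h

theorem sum_prod_add_div_sub_of_odd [CharZero F] {v : ι → F} (hv : Function.Injective v)
    (hodd : Odd (Fintype.card ι)) :
    ∑ i, ∏ j ∈ Finset.univ.erase i, (v i + v j) / (v i - v j) = 1 := by
  -- A node may vanish (u_i = 0 when x_i² = -1). Its own term is then 1, and the others form the
  -- identity at t = -1 for an even number of nonzero nodes, which sums to 0.
  by_cases h0 : ∃ k, v k = 0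
  · obtain ⟨k, hk⟩ := h0
    have hne : ∀ i, i ≠ k → v i ≠ 0 := fun i hi h => hi (hv (h.trans hk.symm))
    have hcard : Fintype.card {i // i ≠ k} = Fintype.card ι - 1 := by
      simp [Fintype.card_subtype_compl]
    have h := sum_prod_sub_mul_div_sub_of_ne_zero (v := fun i : {i // i ≠ k} => v i)
      (fun i j h => Subtype.ext (hv h)) (fun i => hne i i.2) (t := -1) (by norm_num)
    have hev : Even (Fintype.card ι - 1) := by
      obtain ⟨m, hm⟩ := hodd
      exact ⟨m, by omega⟩
    rw [hcard, hev.neg_one_pow, sub_self, zero_div] at h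
    rw [← Finset.add_sum_erase _ _ (Finset.mem_univ k)]
    have h1 : ∏ j ∈ Finset.univ.erase k, (v k + v j) / (v k - v j) = 1 := by
      rw [Finset.prod_congr rfl (g := fun _ => (-1 : F))]
      · rw [Finset.prod_const, Finset.card_erase_of_mem (Finset.mem_univ k), Finset.card_univ,
          hev.neg_one_pow]
      · intro j hj
        rw [hk, zero_add, zero_sub, div_neg, div_self (hne j (Finset.ne_of_mem_erase hj))]
    rw [h1, add_eq_left, ← h]
    have hsub : ∀ f : ι → F, ∑ i ∈ Finset.univ.erase k, f i = ∑ i : {i // i ≠ k}, f i :=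
      fun f => Finset.sum_subtype _ (by simp) f
    rw [hsub]
    refine Finset.sum_congr rfl fun i _ => ?_
    rw [← Finset.mul_prod_erase _ _ (Finset.mem_erase.2 ⟨i.2.symm, Finset.mem_univ k⟩), hk,
      add_zero, sub_zero, div_self (hne i i.2), one_mul]
    have hmap : ((Finset.univ : Finset ι).erase i).erase k =
        ((Finset.univ : Finset {i // i ≠ k}).erase i).map (Function.Embedding.subtype _) := by
      ext j
      simp [and_comm]
    rw [hmap, Finset.prod_map]
    refine Finset.prod_congr rfl fun j _ => ?_
    simp
  · push Not at h0
    have h := sum_prod_sub_mul_div_sub_of_ne_zero hv h0 (t := -1) (by norm_num)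
    rw [hodd.neg_one_pow] at h
    simp only [neg_one_mul, sub_neg_eq_add] at h
    rw [h]
    norm_num

/-- Write (c - v)/(c + v) = 1 - 2v/(v + c); the two parts are the preceding identity and
interpolation with extra node -c and b = -v. This is the induction step for Schur's Pfaffian. -/
theorem sum_div_mul_prod_add_div_sub_of_odd [CharZero F] {v : ι → F} (hv : Function.Injective v)
    (hodd : Odd (Fintype.card ι)) {c : F} (hc : ∀ i, v i + c ≠ 0) :
    ∑ i, (c - v i) / (c + v i) * ∏ j ∈ Finset.univ.erase i, (v i + v j) / (v i - v j) =
      ∏ i, (c - v i) / (c + v i) := by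
  have h := prod_div_add_sum_eq_one hv (c := -c) (fun i h => hc i (by rw [h]; ring))
    (fun i => -v i)
  have h' := sum_prod_add_div_sub_of_odd hv hodd
  simp only [sub_neg_eq_add] at h
  have h1 : ∏ i, (-c + v i) / (-c - v i) = ∏ i, (c - v i) / (c + v i) :=
    Finset.prod_congr rfl fun i _ => by
      rw [← neg_div_neg_eq]
      congr 1 <;> ring
  rw [h1] at h
  have h2 : ∑ i, (c - v i) / (c + v i) *
        ∏ j ∈ Finset.univ.erase i, (v i + v j) / (v i - v j) =
      ∑ i, ∏ j ∈ Finset.univ.erase i, (v i + v j) / (v i - v j) -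
        ∑ i, (v i + v i) / (v i + c) *
          ∏ j ∈ Finset.univ.erase i, (v i + v j) / (v i - v j) := by
    rw [← Finset.sum_sub_distrib]
    refine Finset.sum_congr rfl fun i _ => ?_
    have := hc i
    rw [add_comm c (v i)]
    field_simp
    ring
  linear_combination h2 + h' - h

end LagrangeIdentities

theorem prod_erase_eq_prod_succAbove {M : Type*} [CommMonoid M] {n : ℕ} (p : Fin (n + 1))
    (f : Fin (n + 1) → M) :
    ∏ j ∈ Finset.univ.erase p, f j = ∏ j : Fin n, f (p.succAbove j) := by
  have h : Finset.univ.erase p = Finset.univ.map p.succAboveEmb := by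
    ext j
    simp [Fin.exists_succAbove_eq_iff]
  rw [h, Finset.prod_map]
  rfl

/-! ### The Nimmo-type quotient: recursion and Schur's Pfaffian. -/

section Nimmo

variable {K : Type*} [Field K]

/-- The function `u(x) = x + x⁻¹`. -/
def joukowski (x : K) : K := x + x⁻¹

/-- The values `u_i = x_i + x_i⁻¹` satisfy `u_i ≠ ±u_j` for `i ≠ j`. -/
def JoukowskiGeneric {n : ℕ} (x : Fin n → K) : Prop :=
  ∀ i j, i ≠ j → joukowski (x i) - joukowski (x j) ≠ 0 ∧ joukowski (x i) + joukowski (x j) ≠ 0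

theorem JoukowskiGeneric.comp {n m : ℕ} {x : Fin n → K} (hx : JoukowskiGeneric x)
    {f : Fin m → Fin n} (hf : Function.Injective f) : JoukowskiGeneric fun k => x (f k) :=
  fun i j hij => hx (f i) (f j) (hf.ne hij)

theorem JoukowskiGeneric.injective {n : ℕ} {x : Fin n → K} (hx : JoukowskiGeneric x) :
    Function.Injective fun i => joukowski (x i) := by
  intro i j h
  by_contra hij
  exact (hx i j hij).1 (sub_eq_zero.2 h)

theorem deltaTilde_ne_zero {n : ℕ} {x : Fin n → K} (hx : JoukowskiGeneric x) :
    deltaTilde x ≠ 0 := by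
  refine Finset.prod_ne_zero_iff.2 fun i _ => Finset.prod_ne_zero_iff.2 fun j hj => ?_
  have := hx j i (Finset.mem_Ioi.1 hj).ne'
  exact div_ne_zero this.1 this.2

theorem deltaTilde_succ {n : ℕ} (x : Fin (n + 1) → K) (p : Fin (n + 1)) :
    deltaTilde x = (-1) ^ (p : ℕ) *
      (∏ j : Fin n, (joukowski (x (p.succAbove j)) - joukowski (x p)) /
        (joukowski (x (p.succAbove j)) + joukowski (x p))) *
      deltaTilde fun k => x (p.succAbove k) := by
  have h := Perm.prod_Ioi_comp_eq_sign_mul_prod p.cycleRange.symm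
    (f := fun i j => (joukowski (x j) - joukowski (x i)) / (joukowski (x j) + joukowski (x i)))
    (fun i j => by
      rw [← neg_div, add_comm]
      congr 1
      ring)
  rw [Perm.sign_symm, Fin.sign_cycleRange] at h
  have h2 : ((-1 : K) ^ (p : ℕ)) * (-1) ^ (p : ℕ) = 1 := by rw [← mul_pow]; simp
  rw [Fin.prod_univ_succ, Fin.prod_Ioi_zero] at h
  simp only [Fin.prod_Ioi_succ, Fin.cycleRange_symm_zero, Fin.cycleRange_symm_succ] at h
  push_cast at h
  calc deltaTilde x = (-1) ^ (p : ℕ) * ((-1) ^ (p : ℕ) * deltaTilde x) := by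
        rw [← mul_assoc, h2, one_mul]
    _ = _ := by
        rw [mul_assoc]
        exact congrArg _ h.symm

/-- Converts the change of Δ̃ on deleting x_p into the product found on the Weyl group side. -/
theorem prod_mul_deltaTilde {n : ℕ} {x : Fin (n + 1) → K} (hx : JoukowskiGeneric x)
    (p : Fin (n + 1)) :
    (∏ j : Fin n, (joukowski (x p) + joukowski (x (p.succAbove j))) /
      (joukowski (x p) - joukowski (x (p.succAbove j)))) * deltaTilde x =
      (-1) ^ (p + n : ℕ) * deltaTilde fun k => x (p.succAbove k) := by
  have hprod : (∏ j : Fin n, (joukowski (x p) + joukowski (x (p.succAbove j))) /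
        (joukowski (x p) - joukowski (x (p.succAbove j)))) *
      (∏ j : Fin n, (joukowski (x (p.succAbove j)) - joukowski (x p)) /
        (joukowski (x (p.succAbove j)) + joukowski (x p))) = (-1) ^ n := by
    have : ((-1 : K)) ^ n = ∏ _j : Fin n, (-1 : K) := by simp
    rw [this, ← Finset.prod_mul_distrib]
    refine Finset.prod_congr rfl fun j _ => ?_
    obtain ⟨h1, h2⟩ := hx p (p.succAbove j) (Fin.succAbove_ne p j).symm
    rw [add_comm (joukowski (x (p.succAbove j))), ← neg_sub (joukowski (x p)), neg_div, mul_neg,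
      div_mul_div_cancel₀ h1, div_self h2]
  rw [deltaTilde_succ x p, pow_add, ← hprod]
  ring

/-- The labels of the rows of the matrices in Nimmo-type formulas: variables, parts of a
partition, and an auxiliary symbol. -/
inductive NimmoLabel (K : Type*) where
  | var : K → NimmoLabel K
  | part : ℕ → NimmoLabel K
  | infinity : NimmoLabel K

/-- The skew-symmetric pairing of labels that gives the entries of the Nimmo-type matrices.  The
auxiliary symbol pairs nontrivially with the part `0` only. -/
noncomputable def nimmoPairing (a : ℕ → K) : NimmoLabel K → NimmoLabel K → K
  | .var x, .var y => (joukowski y - joukowski x) / (joukowski y + joukowski x)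
  | .var x, .part r => gTilde a r x
  | .part r, .var x => -gTilde a r x
  | .infinity, .part r => if r = 0 then 1 else 0
  | .part r, .infinity => if r = 0 then -1 else 0
  | _, _ => 0

theorem nimmoPairing_skew (a : ℕ → K) (s t : NimmoLabel K) :
    nimmoPairing a s t = -nimmoPairing a t s := by
  cases s <;> cases t <;> simp only [nimmoPairing, neg_neg, neg_zero]
  · rw [← neg_div, add_comm]
    congr 1
    ring
  · split_ifs <;> simp
  · split_ifs <;> simp

/-- The labels of the variables. -/
def varLabels {n : ℕ} (x : Fin n → K) : List (NimmoLabel K) := List.ofFn fun i => .var (x i)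

omit [Field K] in
theorem length_varLabels {n : ℕ} (x : Fin n → K) : (varLabels x).length = n := by
  simp [varLabels]

theorem pfaffian_nimmoMatrix {n : ℕ} (alpha : List ℕ) (x : Fin n → K) (a : ℕ → K) :
    pfaffian (nimmoMatrix alpha x a) =
      listPf (nimmoPairing a) (varLabels x ++ alpha.map .part) := by
  have hlen : (varLabels x ++ alpha.map NimmoLabel.part).length = n + alpha.length := by
    simp [length_varLabels]
  have hl : ∀ i : Fin n, (varLabels x ++ alpha.map NimmoLabel.part).get
      ((Fin.castAdd alpha.length i).cast hlen.symm) = .var (x i) := by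
    intro i
    rw [List.get_eq_getElem, List.getElem_append_left (by simp [length_varLabels])]
    simp [varLabels]
    rfl
  have hr : ∀ i : Fin alpha.length, (varLabels x ++ alpha.map NimmoLabel.part).get
      ((Fin.natAdd n i).cast hlen.symm) = .part (alpha.get i) := by
    intro i
    rw [List.get_eq_getElem, List.getElem_append_right (by simp [length_varLabels])]
    simp [length_varLabels]
  refine (listPf_eq_of_length_eq hlen fun i j => ?_).symm
  refine Fin.addCases (fun i => ?_) (fun i => ?_) i <;>
    refine Fin.addCases (fun j => ?_) (fun j => ?_) j <;>
    simp only [hl, hr, nimmoMatrix, nimmoPairing, Matrix.reindex_apply, Matrix.submatrix_apply,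
      finSumFinEquiv_symm_apply_castAdd, finSumFinEquiv_symm_apply_natAdd,
      Matrix.fromBlocks_apply₁₁, Matrix.fromBlocks_apply₁₂, Matrix.fromBlocks_apply₂₁,
      Matrix.fromBlocks_apply₂₂, Matrix.neg_apply, Matrix.transpose_apply, Matrix.zero_apply] <;>
    rfl

/-- The Nimmo-type Pfaffian quotient of a sequence `α`. -/
noncomputable def nimmoQuotient {n : ℕ} (alpha : List ℕ) (x : Fin n → K) (a : ℕ → K) : K :=
  1 / deltaTilde x * pfaffian (nimmoMatrix alpha x a)

theorem nimmoQuotient_cons [CharZero K] {n : ℕ} (r : ℕ) (alpha : List ℕ) {x : Fin (n + 1) → K}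
    (hx : JoukowskiGeneric x) (a : ℕ → K) :
    nimmoQuotient (r :: alpha) x a = ∑ p : Fin (n + 1), gTilde a r (x p) *
      (∏ j : Fin n, (joukowski (x p) + joukowski (x (p.succAbove j))) /
        (joukowski (x p) - joukowski (x (p.succAbove j)))) *
      nimmoQuotient alpha (fun k => x (p.succAbove k)) a := by
  -- Parts pair to zero with each other, so the row of `r` meets only variables.
  have hpart : altSum (fun b L' => nimmoPairing a (.part r) b *
      listPf (nimmoPairing a) (varLabels x ++ L')) (alpha.map NimmoLabel.part) = 0 := by
    refine altSum_eq_zero fun b hb L' => ?_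
    obtain ⟨s, _, rfl⟩ := List.mem_map.1 hb
    rw [nimmoPairing, zero_mul]
    all_goals simp
  rw [nimmoQuotient, pfaffian_nimmoMatrix, List.map_cons, listPf_append_cons, length_varLabels,
    listPf_cons (nimmoPairing_skew a), altSum_append, hpart, mul_zero, add_zero, varLabels,
    altSum_ofFn, Finset.mul_sum, Finset.mul_sum]
  refine Finset.sum_congr rfl fun p _ => ?_
  have hd := deltaTilde_ne_zero (hx.comp p.succAbove_right_injective)
  have hd' := deltaTilde_ne_zero hx
  have h := prod_mul_deltaTilde hx p
  rw [← eq_div_iff hd'] at h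
  rw [nimmoQuotient, pfaffian_nimmoMatrix, nimmoPairing, h]
  change _ * (_ * (_ * (_ * listPf _ (varLabels (fun k => x (p.succAbove k)) ++ _)))) = _
  field_simp
  ring

/-- Schur's Pfaffian: expansion along x_0 leaves an odd number of variables, to which the Lagrange
identity with c = u_0 applies. -/
theorem listPf_varLabels [CharZero K] (a : ℕ → K) {n : ℕ} (hn : Even n) {x : Fin n → K}
    (hx : JoukowskiGeneric x) : listPf (nimmoPairing a) (varLabels x) = deltaTilde x := by
  obtain ⟨m, rfl⟩ := hn.exists_two_nsmul
  simp only [smul_eq_mul] at x hx hn ⊢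
  clear hn
  induction m with
  | zero => simp [varLabels, deltaTilde, listPf_nil]
  | succ m ih =>
    change Fin (2 * m + 1 + 1) → K at x
    have hy := hx.comp (Fin.succ_injective (2 * m + 1))
    have h := sum_div_mul_prod_add_div_sub_of_odd hy.injective (by simp)
      (c := joukowski (x 0)) (fun i => (hx i.succ 0 (Fin.succ_ne_zero i)).2)
    have h0 : varLabels x = .var (x 0) :: List.ofFn fun i => .var (x (Fin.succ i)) :=
      List.ofFn_succ
    rw [h0, listPf_cons (nimmoPairing_skew a), altSum_ofFn, deltaTilde_succ x 0]
    simp only [Fin.succAbove_zero, Fin.val_zero, pow_zero, one_mul]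
    have hneg : ∏ j : Fin (2 * m + 1), (joukowski (x j.succ) - joukowski (x 0)) /
        (joukowski (x j.succ) + joukowski (x 0)) =
        -∏ j : Fin (2 * m + 1), (joukowski (x 0) - joukowski (x j.succ)) /
          (joukowski (x 0) + joukowski (x j.succ)) := by
      have : -(1 : K) = ∏ _j : Fin (2 * m + 1), (-1 : K) := by simp [pow_succ]
      rw [← neg_one_mul, this, ← Finset.prod_mul_distrib]
      refine Finset.prod_congr rfl fun j _ => ?_
      rw [neg_one_mul, ← neg_div, neg_sub, add_comm (joukowski (x j.succ))]
    rw [hneg, ← h, neg_mul, Finset.sum_mul, ← Finset.sum_neg_distrib]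
    refine Finset.sum_congr rfl fun p _ => ?_
    have hind := ih (hy.comp p.succAbove_right_injective)
    have hp := prod_mul_deltaTilde hy p
    rw [varLabels] at hind
    rw [nimmoPairing, hind, prod_erase_eq_prod_succAbove, mul_assoc, hp, pow_add, pow_mul,
      neg_one_sq, one_pow, mul_one, ← neg_sub, add_comm (joukowski (x 0))]
    ring

theorem nimmoQuotient_nil [CharZero K] (a : ℕ → K) {n : ℕ} (hn : Even n) {x : Fin n → K}
    (hx : JoukowskiGeneric x) : nimmoQuotient [] x a = 1 := by
  rw [nimmoQuotient, pfaffian_nimmoMatrix, List.map_nil, List.append_nil, listPf_varLabels a hn hx,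
    one_div_mul_cancel (deltaTilde_ne_zero hx)]

theorem nimmoQuotient_zero [CharZero K] (a : ℕ → K) {n : ℕ} (hn : Odd n) {x : Fin n → K}
    (hx : JoukowskiGeneric x) : nimmoQuotient [0] x a = 1 := by
  obtain ⟨m, rfl⟩ := hn
  rw [nimmoQuotient_cons 0 [] hx, ← sum_prod_add_div_sub_of_odd hx.injective (by simp)]
  refine Finset.sum_congr rfl fun p _ => ?_
  rw [nimmoQuotient_nil a (even_two_mul m) (hx.comp p.succAbove_right_injective),
    prod_erase_eq_prod_succAbove, gTilde, if_pos rfl, one_mul, mul_one]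

theorem nimmoQ_eq {n : ℕ} (lam : List ℕ) (x : Fin n → K) (a : ℕ → K) :
    nimmoQ lam x a = if Even (n + lam.length) then nimmoQuotient lam x a
      else nimmoQuotient (lam ++ [0]) x a := rfl

theorem nimmoQ_nil [CharZero K] {n : ℕ} {x : Fin n → K} (hx : JoukowskiGeneric x) (a : ℕ → K) :
    nimmoQ [] x a = 1 := by
  rw [nimmoQ_eq]
  split_ifs with h
  · exact nimmoQuotient_nil a h hx
  · exact nimmoQuotient_zero a (Nat.not_even_iff_odd.1 h) hx

theorem nimmoQ_cons [CharZero K] {n : ℕ} (r : ℕ) (lam : List ℕ) {x : Fin (n + 1) → K}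
    (hx : JoukowskiGeneric x) (a : ℕ → K) :
    nimmoQ (r :: lam) x a = ∑ p : Fin (n + 1), gTilde a r (x p) *
      (∏ j : Fin n, (joukowski (x p) + joukowski (x (p.succAbove j))) /
        (joukowski (x p) - joukowski (x (p.succAbove j)))) *
      nimmoQ lam (fun k => x (p.succAbove k)) a := by
  -- Removing a part and a variable keeps the parity, so the extra 0 is present on both sides or on
  -- neither.
  have h : Even (n + 1 + (r :: lam).length) ↔ Even (n + lam.length) := by
    rw [List.length_cons, show n + 1 + (lam.length + 1) = n + lam.length + 2 by ring]
    simp [Nat.even_add]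
  simp only [nimmoQ_eq, h]
  split_ifs
  · exact nimmoQuotient_cons r lam hx a
  · exact nimmoQuotient_cons r (lam ++ [0]) hx a

end Nimmo

/-! ### Recursion for the sum over the Weyl group, and Macdonald's formula. -/

section WeylSum

variable {K : Type*} [Field K]

/-- The factor of the Hall–Littlewood term of type `C` that belongs to a long root. -/
def longRootFactor (t y : K) : K := (1 - t * (y ^ 2)⁻¹) / (1 - (y ^ 2)⁻¹)

/-- The factor of the Hall–Littlewood term of type `C` that belongs to a pair of variables. -/
def shortRootFactor (t y z : K) : K :=
  (1 - t * y⁻¹ * z) / (1 - y⁻¹ * z) * ((1 - t * y⁻¹ * z⁻¹) / (1 - y⁻¹ * z⁻¹))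

theorem shortRootFactor_zpow (t y z : K) (e : ℤˣ) :
    shortRootFactor t y (z ^ (e : ℤ)) = shortRootFactor t y z := by
  rcases Int.units_eq_one_or e with rfl | rfl
  · simp
  · simp [shortRootFactor, mul_comm]

theorem partAt_cons_succ (r : ℕ) (lam : List ℕ) (i : ℕ) :
    partAt (r :: lam) (i + 1) = partAt lam i := by
  simp [partAt]

theorem partAt_tail (lam : List ℕ) (i : ℕ) : partAt lam (i + 1) = partAt lam.tail i := by
  cases lam <;> simp [partAt]

theorem hallLittlewoodTerm_succ {n : ℕ} (lam : List ℕ) (a : ℕ → K) (t : K)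
    (x : Fin (n + 1) → K) :
    hallLittlewoodTerm lam a t x =
      factorialMonomial a (x 0) (partAt lam 0) * longRootFactor t (x 0) *
        (∏ j : Fin n, shortRootFactor t (x 0) (x j.succ)) *
        hallLittlewoodTerm lam.tail a t fun k => x k.succ := by
  simp only [hallLittlewoodTerm, Fin.prod_univ_succ (n := n), Fin.prod_Ioi_zero, Fin.prod_Ioi_succ,
    Fin.val_succ, partAt_tail, Fin.val_zero]
  rw [show (∏ j : Fin n, shortRootFactor t (x 0) (x j.succ)) = _ from rfl]
  simp only [shortRootFactor, longRootFactor]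
  ring

/-- The sum of the Hall–Littlewood terms over the Weyl group of type `C`. -/
noncomputable def weylSum {n : ℕ} (lam : List ℕ) (a : ℕ → K) (t : K) (x : Fin n → K) : K :=
  ∑ w : Perm (Fin n) × (Fin n → ℤˣ),
    hallLittlewoodTerm lam a t (fun i => x (w.1 i) ^ ((w.2 i : ℤˣ) : ℤ))

/-- By `shortRootFactor_zpow`, the factors joining the first variable to the others ignore their
signs, and as a product also their order; they come out of the inner sum. -/
theorem weylSum_succ {n : ℕ} (lam : List ℕ) (a : ℕ → K) (t : K) (x : Fin (n + 1) → K) :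
    weylSum lam a t x = ∑ p : Fin (n + 1), ∑ e : ℤˣ,
      factorialMonomial a (x p ^ (e : ℤ)) (partAt lam 0) * longRootFactor t (x p ^ (e : ℤ)) *
        (∏ j : Fin n, shortRootFactor t (x p ^ (e : ℤ)) (x (p.succAbove j))) *
        weylSum lam.tail a t fun k => x (p.succAbove k) := by
  rw [weylSum, Fintype.sum_prod_type, sum_perm_fin_succ]
  refine Finset.sum_congr rfl fun p _ => ?_
  simp only [weylSum, Fintype.sum_prod_type, Finset.mul_sum]
  rw [Finset.sum_comm (s := (Finset.univ : Finset ℤˣ))]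
  refine Finset.sum_congr rfl fun s _ => ?_
  rw [← (Fin.consEquiv fun _ => ℤˣ).sum_comp, Fintype.sum_prod_type]
  refine Finset.sum_congr rfl fun e _ => Finset.sum_congr rfl fun d _ => ?_
  rw [hallLittlewoodTerm_succ]
  simp only [cycleRange_mul_decomposeFin_zero, cycleRange_mul_decomposeFin_succ,
    Fin.consEquiv_apply, Fin.cons_zero, Fin.cons_succ, shortRootFactor_zpow]
  congr 2
  exact Equiv.prod_comp s fun j => shortRootFactor t (x p ^ (e : ℤ)) (x (p.succAbove j))

/-- The elements `x_i` and `x_i⁻¹` are nonzero and pairwise distinct. -/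
def SignedGeneric {n : ℕ} (x : Fin n → K) : Prop :=
  (∀ i, x i ≠ 0) ∧ Function.Injective fun q : Fin n × ℤˣ => x q.1 ^ (q.2 : ℤ)

theorem SignedGeneric.comp {n m : ℕ} {x : Fin n → K} (hx : SignedGeneric x)
    {f : Fin m → Fin n} (hf : Function.Injective f) : SignedGeneric fun k => x (f k) := by
  refine ⟨fun i => hx.1 (f i), fun q q' h => ?_⟩
  have := @hx.2 (f q.1, q.2) (f q'.1, q'.2) h
  rw [Prod.mk.injEq] at this
  exact Prod.ext (hf this.1) this.2

theorem SignedGeneric.map {L : Type*} [Field L] {n : ℕ} {x : Fin n → K} (hx : SignedGeneric x)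
    (f : K →+* L) : SignedGeneric fun k => f (x k) := by
  refine ⟨fun i => (map_ne_zero f).2 (hx.1 i), fun q q' h => hx.2 (f.injective ?_)⟩
  simpa only [map_zpow₀] using h

theorem sub_mul_div_sub_eq {y : K} (hy : y ≠ 0) (t z : K) :
    (y - t * z) / (y - z) = (1 - t * y⁻¹ * z) / (1 - y⁻¹ * z) := by
  rw [← mul_div_mul_left (y - t * z) (y - z) (inv_ne_zero hy), mul_sub, mul_sub,
    inv_mul_cancel₀ hy]
  ring_nf

theorem sum_rootFactors {n : ℕ} {x : Fin (n + 1) → K} (hx : SignedGeneric x) {t : K}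
    (ht : t ≠ 1) :
    ∑ p : Fin (n + 1), ∑ e : ℤˣ, longRootFactor t (x p ^ (e : ℤ)) *
        ∏ j : Fin n, shortRootFactor t (x p ^ (e : ℤ)) (x (p.succAbove j)) =
      (1 - t ^ (2 * (n + 1))) / (1 - t) := by
  have h := sum_prod_sub_mul_div_sub_of_ne_zero hx.2 (fun q => zpow_ne_zero _ (hx.1 q.1)) ht
  rw [Fintype.card_prod, Fintype.card_fin, Fintype.card_units_int, mul_comm] at h
  rw [← h, Fintype.sum_prod_type]
  refine Finset.sum_congr rfl fun p _ => Finset.sum_congr rfl fun e _ => ?_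
  -- The Lagrange nodes are all x_i^{±1}. The inverse of the chosen node gives the long root factor;
  -- the other nodes combine in pairs x_j^{±1} into short root factors.
  have hset : (Finset.univ : Finset (Fin (n + 1) × ℤˣ)).erase (p, e) =
      Finset.cons (p, -e) (Finset.univ.erase p ×ˢ Finset.univ) (by simp) := by
    ext ⟨q, d⟩
    have hd : d = -e ↔ d ≠ e := by
      rcases Int.units_eq_one_or e with rfl | rfl <;>
        rcases Int.units_eq_one_or d with rfl | rfl <;> decide
    simp only [Finset.mem_erase, Finset.mem_univ, Finset.mem_cons, Finset.mem_product,
      Prod.mk.injEq, ne_eq, and_true, hd]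
    tauto
  have hy : x p ^ (e : ℤ) ≠ 0 := zpow_ne_zero _ (hx.1 p)
  rw [hset, Finset.prod_cons, Finset.prod_product]
  simp only [sub_mul_div_sub_eq hy]
  rw [prod_erase_eq_prod_succAbove p (fun q => ∏ d : ℤˣ,
    (1 - t * (x p ^ (e : ℤ))⁻¹ * x q ^ (d : ℤ)) / (1 - (x p ^ (e : ℤ))⁻¹ * x q ^ (d : ℤ)))]
  congr 1
  · rw [longRootFactor, Units.val_neg, zpow_neg, pow_two, mul_inv, mul_assoc]
  · refine Finset.prod_congr rfl fun j _ => ?_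
    rw [show (Finset.univ : Finset ℤˣ) = {1, -1} from rfl, Finset.prod_pair (by decide), shortRootFactor]
    simp

/-- Macdonald's formula for the Poincaré polynomial of the Weyl group of type `C`. -/
theorem weylSum_nil (a : ℕ → K) {t : K} (ht : t ≠ 1) {n : ℕ} {x : Fin n → K}
    (hx : SignedGeneric x) :
    weylSum [] a t x = ∏ i ∈ Finset.range n, (1 - t ^ (2 * (i + 1))) / (1 - t) := by
  induction n with
  | zero => simp [weylSum, hallLittlewoodTerm]
  | succ n ih =>
    rw [weylSum_succ, Finset.prod_range_succ, ← sum_rootFactors hx ht, Finset.mul_sum]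
    refine Finset.sum_congr rfl fun p _ => ?_
    rw [Finset.mul_sum]
    refine Finset.sum_congr rfl fun e _ => ?_
    rw [List.tail_nil, ih (hx.comp p.succAbove_right_injective)]
    simp [partAt, factorialMonomial]
    ring

theorem IsStrictPartition.tail {r : ℕ} {lam : List ℕ} (h : IsStrictPartition (r :: lam)) :
    IsStrictPartition lam :=
  ⟨h.1.tail, fun s hs => h.2 s (List.mem_cons_of_mem r hs)⟩

theorem partMultiplicity_nil (n : ℕ) : partMultiplicity n [] 0 = n := by
  simp [partMultiplicity, partAt]

theorem partMultiplicity_cons {r : ℕ} (hr : r ≠ 0) (n : ℕ) (lam : List ℕ) :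
    partMultiplicity (n + 1) (r :: lam) 0 = partMultiplicity n lam 0 := by
  simp only [partMultiplicity, Fin.card_filter_univ_succ, Fin.val_zero, Fin.val_succ,
    partAt_cons_succ]
  rw [if_neg]
  simpa [partAt] using hr

theorem IsStrictPartition.partAt_injective {lam : List ℕ} (h : IsStrictPartition lam) {i j : ℕ}
    (hi : partAt lam i ≠ 0) (hij : partAt lam i = partAt lam j) : i = j := by
  have hlt : ∀ k, partAt lam k ≠ 0 → k < lam.length := by
    intro k hk
    by_contra hle
    exact hk (List.getD_eq_default _ _ (not_lt.1 hle))
  have hi' := hlt i hi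
  have hj' := hlt j (hij ▸ hi)
  rw [partAt, partAt, List.getD_eq_getElem _ _ hi', List.getD_eq_getElem _ _ hj'] at hij
  have hnd : lam.Nodup := h.1.imp fun hab => hab.ne'
  exact (hnd.getElem_inj_iff).1 hij

/-- Each positive part has multiplicity one and contributes (1 - t)/(1 - t) = 1; only the zeros
count. -/
theorem stabilizerPoincare_of_isStrictPartition {lam : List ℕ} (h : IsStrictPartition lam)
    (n : ℕ) {t : K} (ht : t ≠ 1) :
    stabilizerPoincare n lam t =
      ∏ i ∈ Finset.range (partMultiplicity n lam 0), (1 - t ^ (2 * (i + 1))) / (1 - t) := by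
  rw [stabilizerPoincare, Finset.prod_eq_one (s := Finset.erase _ _), mul_one]
  intro k hk
  obtain ⟨hk0, hk⟩ := Finset.mem_erase.1 hk
  obtain ⟨i, -, rfl⟩ := Finset.mem_image.1 hk
  have : partMultiplicity n lam (partAt lam i) = 1 := by
    rw [partMultiplicity, Finset.card_eq_one]
    refine ⟨i, Finset.eq_singleton_iff_unique_mem.2 ⟨by simp, fun j hj => Fin.ext ?_⟩⟩
    exact (h.partAt_injective hk0 (Finset.mem_filter.1 hj).2.symm).symm
  rw [this]
  simp [div_self (sub_ne_zero.2 ht.symm)]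

end WeylSum

/-! ### Polynomiality in t and the value at t = -1. -/

section PolynomialForm

open Polynomial

variable {K : Type*} [Field K]

/-- The long root factor as a polynomial in `t`. -/
noncomputable def longRootPolynomial (y : K) : K[X] :=
  (1 - X * C (y ^ 2)⁻¹) * C (1 - (y ^ 2)⁻¹)⁻¹

/-- The short root factor as a polynomial in `t`. -/
noncomputable def shortRootPolynomial (y z : K) : K[X] :=
  (1 - X * C (y⁻¹ * z)) * C (1 - y⁻¹ * z)⁻¹ * ((1 - X * C (y⁻¹ * z⁻¹)) * C (1 - y⁻¹ * z⁻¹)⁻¹)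

theorem eval_longRootPolynomial (t y : K) :
    (longRootPolynomial y).eval t = longRootFactor t y := by
  simp only [longRootPolynomial, longRootFactor, eval_mul, eval_sub, eval_one, eval_X, eval_C,
    div_eq_mul_inv]

theorem eval_shortRootPolynomial (t y z : K) :
    (shortRootPolynomial y z).eval t = shortRootFactor t y z := by
  simp [shortRootPolynomial, shortRootFactor, div_eq_mul_inv, mul_assoc]

theorem algebraMap_longRootPolynomial (y : K) :
    algebraMap K[X] (RatFunc K) (longRootPolynomial y) =
      longRootFactor RatFunc.X (RatFunc.C y) := by
  simp only [longRootPolynomial, longRootFactor, map_mul, map_sub, map_one, RatFunc.algebraMap_X,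
    RatFunc.algebraMap_C, map_inv₀, map_pow, div_eq_mul_inv]

theorem algebraMap_shortRootPolynomial (y z : K) :
    algebraMap K[X] (RatFunc K) (shortRootPolynomial y z) =
      shortRootFactor RatFunc.X (RatFunc.C y) (RatFunc.C z) := by
  simp only [shortRootPolynomial, shortRootFactor, map_mul, map_sub, map_one,
    RatFunc.algebraMap_X, RatFunc.algebraMap_C, map_inv₀, div_eq_mul_inv, mul_assoc]

theorem ratFunc_factorialMonomial (a : ℕ → K) (y : K) (r : ℕ) :
    factorialMonomial (fun k => RatFunc.C (a k)) (RatFunc.C y) r =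
      RatFunc.C (factorialMonomial a y r) := by
  simp [factorialMonomial]

theorem one_sub_ratFuncX_pow_ne_zero {k : ℕ} (hk : k ≠ 0) : 1 - (RatFunc.X : RatFunc K) ^ k ≠ 0 := by
  have h : (X : K[X]) ^ k - C 1 ≠ 0 := X_pow_sub_C_ne_zero (Nat.pos_of_ne_zero hk) 1
  intro h0
  apply h
  apply RatFunc.algebraMap_injective K
  rw [map_sub, map_pow, RatFunc.algebraMap_X, C_1, map_one, map_zero, ← neg_sub, h0, neg_zero]

theorem ratFuncX_ne_one : (RatFunc.X : RatFunc K) ≠ 1 := by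
  have := one_sub_ratFuncX_pow_ne_zero (K := K) one_ne_zero
  rw [pow_one] at this
  exact fun h => this (by rw [h, sub_self])

theorem factorialHallLittlewoodCGeneric_eq {n : ℕ} (lam : List ℕ) (x : Fin n → K) (a : ℕ → K) :
    factorialHallLittlewoodCGeneric lam x a = (stabilizerPoincare n lam RatFunc.X)⁻¹ *
      weylSum lam (fun k => RatFunc.C (a k)) RatFunc.X fun i => RatFunc.C (x i) := rfl

theorem factorialHallLittlewoodCGeneric_nil {n : ℕ} {x : Fin n → K} (hx : SignedGeneric x)
    (a : ℕ → K) : factorialHallLittlewoodCGeneric [] x a = 1 := by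
  have hstrict : IsStrictPartition [] := ⟨List.Pairwise.nil, by simp⟩
  have h := weylSum_nil (fun k => RatFunc.C (a k)) ratFuncX_ne_one (hx.map RatFunc.C)
  rw [factorialHallLittlewoodCGeneric_eq, h,
    stabilizerPoincare_of_isStrictPartition hstrict n ratFuncX_ne_one, partMultiplicity_nil,
    inv_mul_cancel₀]
  refine Finset.prod_ne_zero_iff.2 fun i _ => div_ne_zero ?_ ?_
  · exact one_sub_ratFuncX_pow_ne_zero (by omega)
  · exact sub_ne_zero.2 ratFuncX_ne_one.symm

/-- The normalizations for `r :: lam` and `lam` coincide, and t occurs only in numerators of the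
root factors, so the recursion creates no poles. -/
theorem factorialHallLittlewoodCGeneric_cons {n : ℕ} {r : ℕ} {lam : List ℕ}
    (h : IsStrictPartition (r :: lam)) (x : Fin (n + 1) → K) (a : ℕ → K) :
    factorialHallLittlewoodCGeneric (r :: lam) x a = ∑ p : Fin (n + 1), ∑ e : ℤˣ,
      algebraMap K[X] (RatFunc K) (C (factorialMonomial a (x p ^ (e : ℤ)) r) *
        longRootPolynomial (x p ^ (e : ℤ)) *
        ∏ j : Fin n, shortRootPolynomial (x p ^ (e : ℤ)) (x (p.succAbove j))) *
      factorialHallLittlewoodCGeneric lam (fun k => x (p.succAbove k)) a := by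
  have hs := weylSum_succ (r :: lam) (fun k => RatFunc.C (a k)) RatFunc.X
    (fun i => RatFunc.C (x i))
  have hr : r ≠ 0 := (h.2 r (by simp)).ne'
  rw [factorialHallLittlewoodCGeneric_eq, hs,
    stabilizerPoincare_of_isStrictPartition h _ ratFuncX_ne_one, partMultiplicity_cons hr,
    ← stabilizerPoincare_of_isStrictPartition h.tail _ ratFuncX_ne_one, Finset.mul_sum]
  refine Finset.sum_congr rfl fun p _ => ?_
  rw [Finset.mul_sum]
  refine Finset.sum_congr rfl fun e _ => ?_
  rw [factorialHallLittlewoodCGeneric_eq, map_mul, map_mul,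
    map_prod, algebraMap_longRootPolynomial, RatFunc.algebraMap_C]
  simp only [algebraMap_shortRootPolynomial, ← map_zpow₀, ratFunc_factorialMonomial,
    List.tail_cons]
  simp only [partAt, List.getD_cons_zero]
  ring

theorem shortRootFactor_neg_one {y z : K} (hy : y ≠ 0) (hz : z ≠ 0) :
    shortRootFactor (-1) y z =
      (joukowski y + joukowski z) / (joukowski y - joukowski z) := by
  rw [shortRootFactor, div_mul_div_comm, ← mul_div_mul_left _ _ hy, joukowski, joukowski]
  congr 1 <;> field_simp <;> ring

theorem joukowski_zpow (y : K) (e : ℤˣ) : joukowski (y ^ (e : ℤ)) = joukowski y := by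
  rcases Int.units_eq_one_or e with rfl | rfl
  · simp
  · simp [joukowski, add_comm]

theorem longRootFactor_neg_one {y : K} (hy : y ≠ 0) :
    longRootFactor (-1) y = (y + y⁻¹) / (y - y⁻¹) := by
  rw [longRootFactor, ← mul_div_mul_left _ _ hy]
  congr 1 <;> field_simp
  ring

/-- At t = -1 the long root factor is odd under y ↦ y⁻¹, whence the difference in g̃. Each part uses
up one 2 of 2^{l(λ)}. -/
theorem two_mul_sum_factorialMonomial_mul_longRootFactor (a : ℕ → K) {r : ℕ} (hr : r ≠ 0) {y : K}
    (hy : y ≠ 0) :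
    2 * ∑ e : ℤˣ, factorialMonomial a (y ^ (e : ℤ)) r * longRootFactor (-1) (y ^ (e : ℤ)) =
      gTilde a r y := by
  rw [show (Finset.univ : Finset ℤˣ) = {1, -1} from rfl, Finset.sum_pair (by decide), gTilde,
    if_neg hr]
  simp only [Units.val_one, zpow_one, Units.val_neg, zpow_neg]
  rw [longRootFactor_neg_one hy, longRootFactor_neg_one (inv_ne_zero hy), inv_inv,
    ← neg_sub y y⁻¹, div_neg, add_comm y⁻¹]
  ring

theorem exists_polynomial_eq_factorialHallLittlewoodCGeneric [CharZero K] {lam : List ℕ}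
    (h : IsStrictPartition lam) {n : ℕ} (hn : lam.length ≤ n) {x : Fin n → K}
    (hx : SignedGeneric x) (hx' : JoukowskiGeneric x) (a : ℕ → K) :
    ∃ P : K[X], factorialHallLittlewoodCGeneric lam x a = algebraMap K[X] (RatFunc K) P ∧
      2 ^ lam.length * P.eval (-1) = nimmoQ lam x a := by
  induction lam generalizing n with
  | nil =>
    exact ⟨1, by rw [factorialHallLittlewoodCGeneric_nil hx, map_one],
      by rw [nimmoQ_nil hx']; simp⟩
  | cons r lam ih =>
    obtain ⟨n, rfl⟩ : ∃ m, n = m + 1 := ⟨n - 1, by simp at hn; omega⟩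
    have hr : r ≠ 0 := (h.2 r (by simp)).ne'
    choose P hP hPe using fun p : Fin (n + 1) => ih h.tail (by simpa using hn)
      (hx.comp p.succAbove_right_injective) (hx'.comp p.succAbove_right_injective)
    refine ⟨∑ p : Fin (n + 1), ∑ e : ℤˣ, (C (factorialMonomial a (x p ^ (e : ℤ)) r) *
      longRootPolynomial (x p ^ (e : ℤ)) *
      ∏ j : Fin n, shortRootPolynomial (x p ^ (e : ℤ)) (x (p.succAbove j))) * P p, ?_, ?_⟩
    · rw [factorialHallLittlewoodCGeneric_cons h, map_sum]
      refine Finset.sum_congr rfl fun p _ => ?_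
      rw [map_sum]
      refine Finset.sum_congr rfl fun e _ => ?_
      rw [hP, ← map_mul]
    · rw [nimmoQ_cons r lam hx', eval_finsetSum, Finset.mul_sum]
      refine Finset.sum_congr rfl fun p _ => ?_
      simp only [eval_finsetSum, eval_mul, eval_C, eval_prod, eval_longRootPolynomial,
        eval_shortRootPolynomial, shortRootFactor_neg_one (zpow_ne_zero _ (hx.1 p)) (hx.1 _),
        joukowski_zpow]
      rw [← Finset.sum_mul, ← Finset.sum_mul, ← hPe p, List.length_cons, pow_succ,
        ← two_mul_sum_factorialMonomial_mul_longRootFactor a hr (hx.1 p)]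
      ring

theorem signedGeneric_of_sq_ne {n : ℕ} {x : Fin n → K} (hx0 : ∀ i, x i ≠ 0)
    (hx1 : ∀ i, x i ^ 2 ≠ 1) (hx2 : ∀ i j, i ≠ j → x i ^ 2 ≠ x j ^ 2)
    (hx3 : ∀ i j, i ≠ j → (x i * x j) ^ 2 ≠ 1) : SignedGeneric x := by
  refine ⟨hx0, ?_⟩
  rintro ⟨i, e⟩ ⟨j, d⟩ h
  simp only at h
  have hi := hx0 i
  have hj := hx0 j
  by_cases hij : i = j
  · subst hij
    rcases Int.units_eq_one_or e with rfl | rfl <;> rcases Int.units_eq_one_or d with rfl | rfl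
    · rfl
    · simp only [Units.val_one, zpow_one, Units.val_neg, zpow_neg] at h
      exact absurd (by rw [pow_two]; nth_rewrite 1 [h]; exact inv_mul_cancel₀ hi) (hx1 i)
    · simp only [Units.val_one, zpow_one, Units.val_neg, zpow_neg] at h
      exact absurd (by rw [pow_two]; nth_rewrite 1 [← h]; exact inv_mul_cancel₀ hi) (hx1 i)
    · rfl
  · exfalso
    rcases Int.units_eq_one_or e with rfl | rfl <;> rcases Int.units_eq_one_or d with rfl | rfl <;>
      simp only [Units.val_one, zpow_one, Units.val_neg, zpow_neg] at h
    · exact hx2 i j hij (by rw [h])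
    · exact hx3 i j hij (by rw [h, inv_mul_cancel₀ hj, one_pow])
    · exact hx3 i j hij (by rw [← h, mul_inv_cancel₀ hi, one_pow])
    · exact hx2 i j hij (by rw [inv_injective h])

/-- u_i ∓ u_j = (x_i ∓ x_j)(x_i x_j ∓ 1)/(x_i x_j). -/
theorem joukowskiGeneric_of_sq_ne {n : ℕ} {x : Fin n → K} (hx0 : ∀ i, x i ≠ 0)
    (hx2 : ∀ i j, i ≠ j → x i ^ 2 ≠ x j ^ 2)
    (hx3 : ∀ i j, i ≠ j → (x i * x j) ^ 2 ≠ 1) : JoukowskiGeneric x := by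
  intro i j hij
  have hi := hx0 i
  have hj := hx0 j
  have h2 : (x i - x j) * (x i + x j) ≠ 0 := fun h => hx2 i j hij (by linear_combination h)
  have h3 : (x i * x j - 1) * (x i * x j + 1) ≠ 0 := fun h => hx3 i j hij (by linear_combination h)
  have hs : joukowski (x i) - joukowski (x j) =
      (x i - x j) * (x i * x j - 1) * (x i * x j)⁻¹ := by
    rw [joukowski, joukowski]
    field_simp
    ring
  have ha : joukowski (x i) + joukowski (x j) =
      (x i + x j) * (x i * x j + 1) * (x i * x j)⁻¹ := by
    rw [joukowski, joukowski]
    field_simp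
    ring
  have hinv := inv_ne_zero (mul_ne_zero hi hj)
  rw [hs, ha]
  exact ⟨mul_ne_zero (mul_ne_zero (left_ne_zero_of_mul h2) (left_ne_zero_of_mul h3)) hinv,
    mul_ne_zero (mul_ne_zero (right_ne_zero_of_mul h2) (right_ne_zero_of_mul h3)) hinv⟩

end PolynomialForm

/-! ### The Schur-type Pfaffian as a relative Pfaffian. -/

section SchurType

variable {K : Type*} [Field K]

/-- The labels of the variables, completed to an even number by the part `0`. -/
def evenVarLabels {n : ℕ} (x : Fin n → K) : List (NimmoLabel K) :=
  varLabels x ++ if Even n then [] else [.part 0]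

/-- The label that completes an odd number of parts. -/
def padLabel (K : Type*) (n : ℕ) : NimmoLabel K := if Even n then .part 0 else .infinity

/-- The labels of the parts, completed to an even number. -/
def evenPartLabels (K : Type*) (n : ℕ) (lam : List ℕ) : List (NimmoLabel K) :=
  lam.map .part ++ if Even lam.length then [] else [padLabel K n]

omit [Field K] in
theorem even_length_evenVarLabels {n : ℕ} (x : Fin n → K) : Even (evenVarLabels x).length := by
  rw [evenVarLabels, List.length_append, length_varLabels]
  split_ifs with h
  · simpa using h
  · simpa [Nat.even_add_one] using h

omit [Field K] in
theorem length_evenPartLabels (n : ℕ) (lam : List ℕ) :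
    (evenPartLabels K n lam).length = evenSize lam.length := by
  rw [evenPartLabels, evenSize]
  split_ifs <;> simp

/-- For both parities this is Q = 1 for the empty partition. -/
theorem listPf_evenVarLabels [CharZero K] {n : ℕ} {x : Fin n → K} (hx : JoukowskiGeneric x)
    (a : ℕ → K) : listPf (nimmoPairing a) (evenVarLabels x) = deltaTilde x := by
  have h := nimmoQ_nil hx a
  rw [nimmoQ_eq, nimmoQuotient, nimmoQuotient, pfaffian_nimmoMatrix, pfaffian_nimmoMatrix] at h
  rw [evenVarLabels]
  have hd := deltaTilde_ne_zero hx
  simp only [List.length_nil, add_zero] at h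
  split_ifs at h ⊢ <;> rw [one_div, inv_mul_eq_one₀ hd] at h <;> exact h.symm

/-- Expansion along ∞ has one nonzero term, the one that deletes the part 0. -/
theorem listPf_append_infinity [CharZero K] (a : ℕ → K) {n : ℕ} (hn : Odd n) (x : Fin n → K)
    {lam : List ℕ} (h0 : ∀ r ∈ lam, r ≠ 0) (hl : Odd lam.length) :
    listPf (nimmoPairing a)
        ((varLabels x ++ [.part 0]) ++ (lam.map .part ++ [.infinity])) =
      listPf (nimmoPairing a) (varLabels x ++ lam.map .part) := by
  have hlen : Odd (varLabels x ++ NimmoLabel.part 0 :: lam.map NimmoLabel.part).length := by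
    rw [List.length_append, length_varLabels, List.length_cons, List.length_map]
    exact hn.add_even hl.add_one
  rw [← List.append_assoc, listPf_append_cons, List.append_nil, List.append_assoc,
    List.singleton_append, hlen.neg_one_pow, listPf_cons (nimmoPairing_skew a), altSum_append,
    altSum_eq_zero, length_varLabels, hn.neg_one_pow, altSum_cons, altSum_eq_zero]
  · simp [nimmoPairing]
  · intro b hb L'
    obtain ⟨r, hr, rfl⟩ := List.mem_map.1 hb
    simp [nimmoPairing, h0 r hr]
  · intro b hb L'
    obtain ⟨i, rfl⟩ := List.mem_ofFn.1 hb
    simp [nimmoPairing]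

theorem nimmoQ_eq_listPf_div [CharZero K] {n : ℕ} {x : Fin n → K} (hx : JoukowskiGeneric x)
    (a : ℕ → K) {lam : List ℕ} (h0 : ∀ r ∈ lam, r ≠ 0) :
    nimmoQ lam x a = listPf (nimmoPairing a) (evenVarLabels x ++ evenPartLabels K n lam) /
      listPf (nimmoPairing a) (evenVarLabels x) := by
  rw [listPf_evenVarLabels hx, nimmoQ_eq, nimmoQuotient, nimmoQuotient, pfaffian_nimmoMatrix,
    pfaffian_nimmoMatrix, evenVarLabels, evenPartLabels, padLabel, one_div,
    div_eq_inv_mul]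
  by_cases hn : Even n <;> by_cases hl : Even lam.length
  · simp [hn, hl, hn.add hl]
  · simp [hn, hl, Nat.even_add]
  -- For n odd and l even, the 0 moves past an even number of parts, so no sign appears.
  · have hodd := Nat.not_even_iff_odd.1 hn
    simp only [hn, hl, Nat.even_add, if_true, if_false, List.append_nil, List.map_append,
      List.map_singleton, iff_true]
    rw [← List.append_assoc, listPf_append_cons, List.append_nil, List.append_assoc,
      List.singleton_append, listPf_append_cons _ (varLabels x), List.length_append,
      length_varLabels, List.length_map, pow_add, hl.neg_one_pow, mul_one]
  · have hodd := Nat.not_even_iff_odd.1 hn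
    have hodd' := Nat.not_even_iff_odd.1 hl
    simp only [hn, hl, Nat.even_add, if_true, if_false]
    rw [listPf_append_infinity a hodd x h0 hodd']

/-- The completing label depends on n only, so the labels at `i` and `j` are the completed labels of
the partition (λ_i, λ_j), or of (λ_i) when `j` is the added position. -/
theorem nimmoQPair_eq [CharZero K] {n : ℕ} {x : Fin n → K} (hx : JoukowskiGeneric x)
    (a : ℕ → K) {lam : List ℕ} (h0 : ∀ r ∈ lam, r ≠ 0) {i j : ℕ} (hij : i < j)
    (hj : j < (evenPartLabels K n lam).length) :
    nimmoQPair (partAt lam i) (partAt lam j) x a =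
      listPf (nimmoPairing a)
          (evenVarLabels x ++ [(evenPartLabels K n lam)[i], (evenPartLabels K n lam)[j]]) /
        listPf (nimmoPairing a) (evenVarLabels x) := by
  have hget : ∀ (k : ℕ) (hk : k < (evenPartLabels K n lam).length), k < lam.length →
      (evenPartLabels K n lam)[k] = .part (partAt lam k) := by
    intro k hk hkl
    simp only [evenPartLabels, partAt]
    rw [List.getElem_append_left (by simpa using hkl), List.getElem_map,
      List.getD_eq_getElem _ _ hkl]
  have hne : ∀ k, k < lam.length → partAt lam k ≠ 0 := by
    intro k hk
    rw [partAt, List.getD_eq_getElem _ _ hk]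
    exact h0 _ (List.getElem_mem hk)
  have hj' := hj
  rw [length_evenPartLabels, evenSize] at hj'
  have hil : i < lam.length := by split_ifs at hj' <;> omega
  rw [hget i _ hil]
  by_cases hjl : j < lam.length
  · rw [hget j hj hjl, nimmoQPair, if_neg (hne j hjl), nimmoQ_eq_listPf_div hx]
    · simp [evenPartLabels]
    · simp [hne i hil, hne j hjl]
  · have hl : ¬ Even lam.length := fun h => by rw [if_pos h] at hj'; omega
    rw [if_neg hl] at hj'
    obtain rfl : j = lam.length := by omega
    have hlast : (evenPartLabels K n lam)[lam.length] = padLabel K n := by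
      simp [evenPartLabels, hl]
    rw [hlast, nimmoQPair, if_pos (by simp [partAt]), nimmoQ_eq_listPf_div hx]
    · simp [evenPartLabels]
    · simp [hne i hil]

theorem nimmoQ_eq_pfaffian_schurMatrix [CharZero K] {n : ℕ} {x : Fin n → K}
    (hx : JoukowskiGeneric x) (a : ℕ → K) {lam : List ℕ} (h0 : ∀ r ∈ lam, r ≠ 0) :
    nimmoQ lam x a = pfaffian (schurMatrix lam x a) := by
  have hZ := even_length_evenVarLabels x
  have hZ0 : listPf (nimmoPairing a) (evenVarLabels x) ≠ 0 := by
    rw [listPf_evenVarLabels hx]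
    exact deltaTilde_ne_zero hx
  have hskew := listPf_append_pair_div_skew (nimmoPairing a) hZ
  rw [nimmoQ_eq_listPf_div hx a h0, listPf_append_eq_mul (nimmoPairing_skew a) hZ hZ0,
    mul_div_cancel_left₀ _ hZ0]
  refine listPf_eq_of_length_eq (length_evenPartLabels n lam) fun i j => ?_
  simp only [schurMatrix, Matrix.of_apply, List.get_eq_getElem, Fin.val_cast]
  split_ifs with hij hji
  · exact nimmoQPair_eq hx a h0 hij _
  · rw [hskew, neg_inj]
    exact nimmoQPair_eq hx a h0 hji _
  · obtain rfl : i = j := le_antisymm (not_lt.1 hji) (not_lt.1 hij)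
    exact (self_eq_neg.1 (hskew _ _)).symm

end SchurType

theorem mainTheorem4 {K : Type*} [Field K] [CharZero K] (n : ℕ) (x : Fin n → K) (a : ℕ → K)
    (hx0 : ∀ i, x i ≠ 0)
    (hx1 : ∀ i, x i ^ 2 ≠ 1)
    (hx2 : ∀ i j, i ≠ j → x i ^ 2 ≠ x j ^ 2)
    (hx3 : ∀ i j, i ≠ j → (x i * x j) ^ 2 ≠ 1) :
    (∀ lam : List ℕ, IsStrictPartition lam → lam.length ≤ n →
      (factorialHallLittlewoodCGeneric lam x a).denom.eval (-1) ≠ 0 ∧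
      factorialSymplecticQ lam x a = nimmoQ lam x a) ∧
    (∀ lam : List ℕ, IsStrictPartition lam →
      nimmoQ lam x a = pfaffian (schurMatrix lam x a)) := by
  have hx := signedGeneric_of_sq_ne hx0 hx1 hx2 hx3
  have hx' := joukowskiGeneric_of_sq_ne hx0 hx2 hx3
  refine ⟨fun lam hlam hn => ?_, fun lam hlam =>
    nimmoQ_eq_pfaffian_schurMatrix hx' a fun r hr => (hlam.2 r hr).ne'⟩
  obtain ⟨P, hP, hPe⟩ :=
    exists_polynomial_eq_factorialHallLittlewoodCGeneric hlam hn hx hx' a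
  -- A polynomial has reduced denominator 1, which settles both the pole and the evaluation.
  rw [factorialSymplecticQ, hP, ← hPe, RatFunc.denom_algebraMap, RatFunc.eval_algebraMap]
  exact ⟨by simp, by simp⟩
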